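/- Let $\mathbb{T}^2=\mathbb{R}^2/\mathbb{Z}^2$, $\Lambda=(-\Delta)^{1/2}$, $R_i=\partial_i(-\Delta)^{-1/2}$ and $R^\perp\theta=(R_2\theta,-R_1\theta)$; all functions are real-valued. Let $0<\gamma<1$. There is a constant $C_0>0$, depending only on $\gamma$, with the following property. Let $f\in H^3(\mathbb{T}^2)$ with $\int f\,dx=0$, and let $\Theta_0\in H^3(\mathbb{T}^2)$ solve $$R^\perp\Theta_0\cdot\nabla\Theta_0+\Lambda^\gamma\Theta_0=f.$$ Then there is a constant $C>0$, depending only on $\gamma$, $f$ and $\Theta_0$, such that every regular global solution $\tilde\theta$ of the perturbation equation $$\partial_t\tilde\theta=-(R^\perp\Theta_0)\cdot\nabla\tilde\theta-(R^\perp\tilde\theta)\cdot\nabla\Theta_0-\Lambda^\gamma\tilde\theta-(R^\perp\tilde\theta)\cdot\nabla\tilde\theta$$ with $$\sup_{t\in[0,\infty)}\|\tilde\theta(t,\cdot)\|_{H^{2-\gamma}}\le C_0$$ satisfies $$\|\tilde\theta(t,\cdot)\|_{H^{2-2\gamma/3}}\le C\,(1+t^{-1/3})\qquad\text{for all } t>0.$$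 Here a regular global solution is a function $\tilde\theta\in C([0,\infty);H^{2-\gamma}(\mathbb{T}^2))\cap C((0,\infty);H^3(\mathbb{T}^2))$ that satisfies the equation for $t>0$, in the sense that each Fourier coefficient of $\tilde\theta$ is differentiable in $t$, with derivative the corresponding Fourier coefficient of the right-hand side. In particular, every solution that is $C^\infty$ on $[0,\infty)\times\mathbb{T}^2$ is a regular global solution. -/

import Mathlib

open MeasureTheory Filter Topology

noncomputable section

namespace SQG

/-- The two-dimensional torus `ℝ² / ℤ²` (with its Haar probability measure `volume`). -/
abbrev T2 : Type := UnitAddTorus (Fin 2)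

/-- The Fourier coefficient `ĝ(k) = ∫ g(x) e^{-2πi k·x} dx` of a real function on the torus. -/
def coeff (g : T2 → ℝ) (k : Fin 2 → ℤ) : ℂ :=
  UnitAddTorus.mFourierCoeff (fun x => (g x : ℂ)) k

/-- The length `|ξ|` of the frequency `ξ = 2πk` of the character `e^{2πi k·x}`. -/
def freq (k : Fin 2 → ℤ) : ℝ :=
  2 * Real.pi * Real.sqrt ((k 0 : ℝ) ^ 2 + (k 1 : ℝ) ^ 2)

/-- `g ∈ H^s(𝕋²)` (used for `s ≥ 0`): `g ∈ L²` and `∑ₖ (1 + |ξ|²)^s |ĝ(k)|² < ∞`. -/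
def MemHs (s : ℝ) (g : T2 → ℝ) : Prop :=
  MemLp g 2 volume ∧ Summable fun k : Fin 2 → ℤ => (1 + freq k ^ 2) ^ s * ‖coeff g k‖ ^ 2

/-- The `H^s(𝕋²)` norm `(∑ₖ (1 + |ξ|²)^s |ĝ(k)|²)^{1/2}` of an element of `H^s(𝕋²)`. -/
def hNorm (s : ℝ) (g : T2 → ℝ) : ℝ :=
  Real.sqrt (∑' k : Fin 2 → ℤ, (1 + freq k ^ 2) ^ s * ‖coeff g k‖ ^ 2)

/-- `θ ∈ C(I; H^s(𝕋²))`. -/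
def ContinuousInHs (s : ℝ) (I : Set ℝ) (θ : ℝ → T2 → ℝ) : Prop :=
  (∀ t ∈ I, MemHs s (θ t)) ∧
    ∀ t ∈ I, Tendsto (fun τ => hNorm s (fun x => θ τ x - θ t x)) (𝓝[I] t) (𝓝 0)

/-- The Fourier multiplier operator `g ↦ ∑ₖ m(k) ĝ(k) e^{2πi k·x}`. For the symbols below,
`m(-k)` is the conjugate of `m(k)`, so the sum is real; for `g ∈ H³(𝕋²)` and those symbols (of
order at most one) the series converges absolutely and uniformly. -/
def multiplier (m : (Fin 2 → ℤ) → ℂ) (g : T2 → ℝ) (x : T2) : ℝ :=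
  (∑' k : Fin 2 → ℤ, m k * coeff g k * UnitAddTorus.mFourier k x).re

/-- The partial derivative `∂ⱼ`, with symbol `2πi kⱼ`. -/
def partialDeriv (j : Fin 2) (g : T2 → ℝ) : T2 → ℝ :=
  multiplier (fun k => 2 * Real.pi * Complex.I * (k j : ℂ)) g

/-- The Riesz transform `Rⱼ = ∂ⱼ (-Δ)^{-1/2}`, with symbol `2πi kⱼ / |2πk|`
(and `0` at `k = 0`). -/
def riesz (j : Fin 2) (g : T2 → ℝ) : T2 → ℝ :=
  multiplier (fun k => 2 * Real.pi * Complex.I * (k j : ℂ) / (freq k : ℂ)) g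

/-- The fractional Laplacian `Λ^γ = (-Δ)^{γ/2}`, with symbol `|2πk|^γ` (used for `γ > 0`). -/
def fracLap (γ : ℝ) (g : T2 → ℝ) : T2 → ℝ :=
  multiplier (fun k => ((freq k ^ γ : ℝ) : ℂ)) g

/-- The transport term `R^⊥ g · ∇ h`, where `R^⊥ g = (R₂ g, -R₁ g)`. -/
def transport (g h : T2 → ℝ) (x : T2) : ℝ :=
  riesz 1 g x * partialDeriv 0 h x + (-(riesz 0 g x)) * partialDeriv 1 h x

/-- `Θ₀` solves the steady equation `R^⊥Θ₀ · ∇Θ₀ + Λ^γ Θ₀ = f` (almost everywhere). -/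
def IsSteady (γ : ℝ) (f Θ₀ : T2 → ℝ) : Prop :=
  ∀ᵐ x : T2, transport Θ₀ Θ₀ x + fracLap γ Θ₀ x = f x

/-- The linearized operator `L_γ θ = -R^⊥Θ₀ · ∇θ - R^⊥θ · ∇Θ₀ - Λ^γ θ`. -/
def linearized (γ : ℝ) (Θ₀ θ : T2 → ℝ) (x : T2) : ℝ :=
  -transport Θ₀ θ x - transport θ Θ₀ x - fracLap γ θ x

/-- The nonlinearity `N(θ) = -R^⊥θ · ∇θ`. -/
def nonlinearity (θ : T2 → ℝ) (x : T2) : ℝ :=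
  -transport θ θ x

/-- Global regular solutions of the perturbation equation `∂ₜθ = L_γ θ + N(θ)`:
`θ ∈ C([0,∞); H^{2-γ}) ∩ C((0,∞); H³)`, and for `t > 0` the equation holds tested against each
character, i.e. every Fourier coefficient of `θ` is differentiable in time with derivative the
corresponding coefficient of the (continuous) function `L_γ θ + N(θ)`. In particular every
solution that is `C^∞` on `[0,∞) × 𝕋²` is of this kind. Only `H³` regularity is asked for, since
`Θ₀` itself, a coefficient of the equation, is only in `H³`. -/
structure IsRegularSolution (γ : ℝ) (Θ₀ : T2 → ℝ) (θ : ℝ → T2 → ℝ) : Prop where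
  continuous_zero : ContinuousInHs (2 - γ) (Set.Ici 0) θ
  continuous_pos : ContinuousInHs 3 (Set.Ioi 0) θ
  equation : ∀ t : ℝ, 0 < t → ∀ k : Fin 2 → ℤ,
    HasDerivAt (fun τ => coeff (θ τ) k)
      (coeff (fun x => linearized γ Θ₀ (θ t) x + nonlinearity (θ t) x) k) t

end SQG

end

noncomputable section

namespace SQG

/-! ### Fourier coefficients and absolutely convergent Fourier series on the torus -/

open UnitAddTorus ComplexConjugate

/-! The proof is an energy estimate on the Fourier side. Let a be the coefficient sequence of the
solution, b that of Θ₀, and E_s = ∑ |ξ|^s |a_k|². Take r = 4 - 4γ/3, twice the target regularity.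
Then E_r' equals -2 E_{r+γ} minus twice the real part of three trilinear sums: two linear in b and
one cubic in a.

The cubic sum has to be absorbed by the dissipation. The kernel of R^⊥g · ∇h is the cross product of
the two frequencies divided by the length of the first. On triples of frequencies with sum zero the
cross product changes only by a sign under permutation, so averaging over the six permutations
leaves differences of powers of the lengths. The cancellation puts one derivative on the lowest
frequency and r/2 on each of the others (`symBracket_le`). Cauchy-Schwarz against the critical norm
gives ∑_{|k| ≤ R} |k||a_k| ≤ (4/γ) R^γ E_{4-2γ}^{1/2} (`sum_low_freq_le`), so the cubic sum is at
most (40/γ) E_{4-2γ}^{1/2} E_{r+γ} (`norm_tri_le`). With the H^{2-γ} norm at most γ/80 this is half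
of E_{r+γ}.

The linear sums are bounded by a constant times E_r, because Θ₀ has three derivatives and r > 2. The
term with velocity b needs a commutator, available because the velocity is divergence free
(`norm_tri_velocity_le`). In the other term the derivative already falls on b
(`norm_tri_transported_le`).

Hence E_r' ≤ -E_{r+γ} + K E_r. Interpolating E_r between E_{4-2γ}, which is bounded, and E_{r+γ}
turns this into E_r' ≤ -(x - K) E_r + A x^{5/3} for every x > 0 (`energy_interpolation`). Choosing x
= K + 1/τ makes τ E_r integrable in closed form and yields E_r ≲ t^{-2/3} for short times, without
reference to an initial value of E_r (`smoothing_of_deriv_le`). The square root is the rate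
t^{-1/3}. -/

/-- The Haar probability measure on the torus used for Fourier coefficients. -/
def haarT2 : Measure T2 := Measure.pi fun _ => AddCircle.haarAddCircle

instance : IsProbabilityMeasure haarT2 := by unfold haarT2; infer_instance

lemma volume_eq_haarT2 : (volume : Measure T2) = haarT2 := by
  have h : (volume : Measure UnitAddCircle) = AddCircle.haarAddCircle := by
    rw [AddCircle.volume_eq_smul_haarAddCircle]; simp
  unfold haarT2
  rw [MeasureTheory.volume_pi]
  simp_rw [h]

lemma mFourierCoeff_eq (f : T2 → ℂ) (n : Fin 2 → ℤ) :
    mFourierCoeff f n = ∫ x, mFourier (-n) x * f x ∂haarT2 := rfl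

lemma norm_mFourier_apply (k : Fin 2 → ℤ) (x : T2) : ‖mFourier k x‖ = 1 := by
  simp [mFourier, fourier_apply, Circle.norm_coe]

lemma mFourierCoeff_mFourier (k n : Fin 2 → ℤ) :
    mFourierCoeff (mFourier k : T2 → ℂ) n = if n = k then 1 else 0 := by
  have h := mFourierBasis_repr (mFourierLp 2 k) n
  rw [show mFourierCoeff (mFourierLp 2 k : T2 → ℂ) n = _ from mFourierCoeff_toLp (mFourier k) n]
    at h
  rw [← h, ← coe_mFourierBasis, mFourierBasis.repr_self, lp.single_apply]
  split_ifs with h1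
  · subst h1; simp
  · simp [h1]

lemma mFourierCoeff_mFourier_mul (k n : Fin 2 → ℤ) (G : T2 → ℂ) :
    mFourierCoeff (fun x => mFourier k x * G x) n = mFourierCoeff G (n - k) := by
  simp only [mFourierCoeff_eq]
  congr 1; ext x
  rw [← mul_assoc, ← mFourier_add]; congr 3; abel

lemma mFourierCoeff_const_mul (c : ℂ) (G : T2 → ℂ) (n : Fin 2 → ℤ) :
    mFourierCoeff (fun x => c * G x) n = c * mFourierCoeff G n := by
  simp only [mFourierCoeff_eq]
  rw [← integral_const_mul]; congr 1; ext x; ring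

/-- The sum of an absolutely convergent Fourier series, as a continuous function. -/
def series (c : (Fin 2 → ℤ) → ℂ) (x : T2) : ℂ := ∑' k, c k * mFourier k x

lemma continuous_series {c : (Fin 2 → ℤ) → ℂ} (hc : Summable fun k => ‖c k‖) :
    Continuous (series c) :=
  continuous_tsum (fun k => by fun_prop) hc fun k x => by
    rw [norm_mul, norm_mFourier_apply, mul_one]

lemma integrable_of_continuous {G : T2 → ℂ} (hG : Continuous G) : Integrable G haarT2 :=
  hG.integrable_of_hasCompactSupport (HasCompactSupport.of_compactSpace G)

/-- Termwise integration turns the product into a convolution. Only one factor has to be an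
absolutely convergent series; continuity suffices for the other. -/
lemma mFourierCoeff_series_mul {c : (Fin 2 → ℤ) → ℂ} (hc : Summable fun k => ‖c k‖)
    {G : T2 → ℂ} (hG : Continuous G) (n : Fin 2 → ℤ) :
    mFourierCoeff (fun x => series c x * G x) n = ∑' k, c k * mFourierCoeff G (n - k) := by
  have key : ∀ k, c k * mFourierCoeff G (n - k)
      = ∫ x, mFourier (-n) x * (c k * (mFourier k x * G x)) ∂haarT2 := by
    intro k
    rw [← mFourierCoeff_mFourier_mul, ← mFourierCoeff_const_mul, mFourierCoeff_eq]
  simp_rw [key]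
  rw [mFourierCoeff_eq, integral_tsum_of_summable_integral_norm (μ := haarT2)
    (F := fun k x => mFourier (-n) x * (c k * (mFourier k x * G x)))]
  · congr 1; ext x
    rw [series, ← tsum_mul_right, ← tsum_mul_left]
    congr 1; ext k; ring
  · intro k
    exact integrable_of_continuous (by fun_prop)
  · have : ∀ k, ∫ x, ‖mFourier (-n) x * (c k * (mFourier k x * G x))‖ ∂haarT2
        = ‖c k‖ * ∫ x, ‖G x‖ ∂haarT2 := by
      intro k
      rw [← integral_const_mul]
      congr 1; ext x
      simp [norm_mFourier_apply]
    simp_rw [this]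
    exact hc.mul_right _

lemma mFourierCoeff_series {c : (Fin 2 → ℤ) → ℂ} (hc : Summable fun k => ‖c k‖)
    (n : Fin 2 → ℤ) : mFourierCoeff (series c) n = c n := by
  have h := mFourierCoeff_series_mul hc (G := fun _ => 1) continuous_const n
  simp only [mul_one] at h
  have h1 : ∀ k, mFourierCoeff (fun _ : T2 => (1 : ℂ)) (n - k) = if k = n then 1 else 0 := by
    intro k
    have h2 := mFourierCoeff_mFourier 0 (n - k)
    rw [mFourier_zero] at h2
    have h3 : (((1 : C(T2, ℂ)) : T2 → ℂ)) = fun _ => 1 := by ext; simp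
    rw [h3] at h2
    rw [h2]
    simp only [sub_eq_zero, eq_comm]
  change mFourierCoeff (fun x => series c x) n = _
  rw [h]
  simp [h1]

/-! ### Real multipliers and their coefficients -/

lemma coeff_neg (g : T2 → ℝ) (k : Fin 2 → ℤ) : coeff g (-k) = conj (coeff g k) := by
  unfold coeff
  rw [mFourierCoeff_eq, mFourierCoeff_eq, ← integral_conj]
  congr 1; ext x
  rw [map_mul, ← mFourier_neg, Complex.conj_ofReal]

/-- Hermitian symmetry makes the terms at k and -k conjugate, so the real part taken in `multiplier`
discards nothing. -/
lemma ofReal_re_series {c : (Fin 2 → ℤ) → ℂ}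
    (hs : ∀ k, c (-k) = conj (c k)) (x : T2) : ((series c x).re : ℂ) = series c x := by
  rw [← Complex.conj_eq_iff_re, series, Complex.conj_tsum,
    ← (Equiv.neg (Fin 2 → ℤ)).tsum_eq]
  congr 1; ext k
  rw [Equiv.neg_apply, map_mul, hs, Complex.conj_conj, ← mFourier_neg, neg_neg]

/-- A symbol is Hermitian when the associated multiplier maps real functions to real functions. -/
def IsHermitian (m : (Fin 2 → ℤ) → ℂ) : Prop := ∀ k, m (-k) = conj (m k)

lemma ofReal_multiplier {m : (Fin 2 → ℤ) → ℂ} {g : T2 → ℝ} (hm : IsHermitian m) (x : T2) :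
    (multiplier m g x : ℂ) = series (fun k => m k * coeff g k) x :=
  ofReal_re_series (fun k => by rw [hm, coeff_neg, map_mul]) x

lemma continuous_multiplier {m : (Fin 2 → ℤ) → ℂ} {g : T2 → ℝ}
    (hc : Summable fun k => ‖m k * coeff g k‖) : Continuous (multiplier m g) :=
  Complex.continuous_re.comp (continuous_series hc)

lemma coeff_multiplier {m : (Fin 2 → ℤ) → ℂ} {g : T2 → ℝ} (hm : IsHermitian m)
    (hc : Summable fun k => ‖m k * coeff g k‖) (n : Fin 2 → ℤ) :
    coeff (multiplier m g) n = m n * coeff g n := by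
  unfold coeff
  simp_rw [ofReal_multiplier hm]
  exact mFourierCoeff_series hc n

lemma coeff_multiplier_mul {m : (Fin 2 → ℤ) → ℂ} {g h : T2 → ℝ} (hm : IsHermitian m)
    (hc : Summable fun k => ‖m k * coeff g k‖) (hh : Continuous h) (n : Fin 2 → ℤ) :
    coeff (fun x => multiplier m g x * h x) n = ∑' k, m k * coeff g k * coeff h (n - k) := by
  conv_lhs => unfold coeff
  simp_rw [Complex.ofReal_mul, ofReal_multiplier hm]
  exact mFourierCoeff_series_mul hc (by fun_prop) n

lemma coeff_add {g h : T2 → ℝ} (hg : Integrable g haarT2) (hh : Integrable h haarT2)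
    (n : Fin 2 → ℤ) : coeff (fun x => g x + h x) n = coeff g n + coeff h n := by
  unfold coeff
  simp only [mFourierCoeff_eq]
  rw [← integral_add]
  · congr 1; ext x; push_cast; ring
  · exact hg.ofReal.bdd_mul (c := 1) (by fun_prop) (ae_of_all _ fun x => (norm_mFourier_apply _ _).le)
  · exact hh.ofReal.bdd_mul (c := 1) (by fun_prop) (ae_of_all _ fun x => (norm_mFourier_apply _ _).le)

lemma coeff_neg_fun (g : T2 → ℝ) (n : Fin 2 → ℤ) :
    coeff (fun x => -g x) n = -coeff g n := by
  unfold coeff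
  simp only [mFourierCoeff_eq]
  rw [← integral_neg]; congr 1; ext x; push_cast; ring

lemma coeff_sub {g h : T2 → ℝ} (hg : Integrable g haarT2) (hh : Integrable h haarT2)
    (n : Fin 2 → ℤ) : coeff (fun x => g x - h x) n = coeff g n - coeff h n := by
  simp_rw [sub_eq_add_neg]
  rw [← coeff_neg_fun]
  exact coeff_add hg hh.neg n

lemma MemHs.integrable {s : ℝ} {g : T2 → ℝ} (hg : MemHs s g) : Integrable g haarT2 := by
  rw [← volume_eq_haarT2]
  have : IsFiniteMeasure (volume : Measure T2) := by rw [volume_eq_haarT2]; infer_instance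
  exact hg.1.integrable (by norm_num)

/-! ### Lattice frequencies, the cross product and convergence of lattice sums -/

lemma freq_eq_norm (k : Fin 2 → ℤ) :
    freq k = 2 * Real.pi * ‖((k 0 : ℝ) : ℂ) + ((k 1 : ℝ) : ℂ) * Complex.I‖ := by
  rw [Complex.norm_add_mul_I, freq]

lemma freq_nonneg (k : Fin 2 → ℤ) : 0 ≤ freq k := by unfold freq; positivity

lemma freq_neg (k : Fin 2 → ℤ) : freq (-k) = freq k := by simp [freq]

lemma freq_zero : freq 0 = 0 := by simp [freq]

lemma freq_add_le (k l : Fin 2 → ℤ) : freq (k + l) ≤ freq k + freq l := by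
  simp only [freq_eq_norm, ← mul_add]
  gcongr
  refine le_trans (le_of_eq ?_) (norm_add_le _ _)
  congr 1; simp; ring

lemma freq_sq (k : Fin 2 → ℤ) :
    freq k ^ 2 = (2 * Real.pi) ^ 2 * ((k 0 : ℝ) ^ 2 + (k 1 : ℝ) ^ 2) := by
  rw [freq, mul_pow, Real.sq_sqrt (by positivity)]

lemma one_le_sq_add_sq {k : Fin 2 → ℤ} (hk : k ≠ 0) :
    (1 : ℝ) ≤ (k 0 : ℝ) ^ 2 + (k 1 : ℝ) ^ 2 := by
  have h : 1 ≤ (k 0) ^ 2 + (k 1) ^ 2 := by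
    by_contra h
    apply hk
    have h0 : k 0 = 0 := by nlinarith [sq_nonneg (k 0), sq_nonneg (k 1)]
    have h1 : k 1 = 0 := by nlinarith [sq_nonneg (k 0), sq_nonneg (k 1)]
    ext i; fin_cases i <;> simp [h0, h1]
  exact_mod_cast h

lemma two_pi_sq_ge : (4 : ℝ) ≤ (2 * Real.pi) ^ 2 := by nlinarith [Real.pi_gt_three]

lemma one_le_freq {k : Fin 2 → ℤ} (hk : k ≠ 0) : 1 ≤ freq k := by
  have := freq_sq k
  have h1 := one_le_sq_add_sq hk
  nlinarith [freq_nonneg k, two_pi_sq_ge]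

lemma freq_pos {k : Fin 2 → ℤ} (hk : k ≠ 0) : 0 < freq k := by linarith [one_le_freq hk]

/-- The cross product of the frequencies `2πk` and `2πl`. -/
def cross (k l : Fin 2 → ℤ) : ℝ :=
  (2 * Real.pi) ^ 2 * ((k 0 : ℝ) * (l 1 : ℝ) - (k 1 : ℝ) * (l 0 : ℝ))

lemma abs_cross_le (k l : Fin 2 → ℤ) : |cross k l| ≤ freq k * freq l := by
  apply abs_le_of_sq_le_sq _ (mul_nonneg (freq_nonneg _) (freq_nonneg _))
  rw [mul_pow, freq_sq, freq_sq, cross, mul_pow]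
  have : 0 ≤ ((2 * Real.pi) ^ 2) ^ 2 * ((k 0 : ℝ) * l 0 + k 1 * l 1) ^ 2 := by positivity
  nlinarith

lemma cross_comm (k l : Fin 2 → ℤ) : cross l k = -cross k l := by unfold cross; ring

lemma cross_neg_add (k l : Fin 2 → ℤ) : cross k (-(k + l)) = -cross k l := by
  simp [cross]; ring

lemma cross_add_neg (k l : Fin 2 → ℤ) : cross l (-(k + l)) = cross k l := by
  simp [cross]; ring

lemma norm_le_freq (k : Fin 2 → ℤ) : ‖k‖ ≤ freq k := by
  rw [pi_norm_le_iff_of_nonneg (freq_nonneg k)]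
  intro i
  rw [Int.norm_eq_abs]
  apply abs_le_of_sq_le_sq _ (freq_nonneg k)
  rw [freq_sq]
  have := two_pi_sq_ge
  fin_cases i
  · simp only [Fin.zero_eta]; nlinarith [sq_nonneg (k 0 : ℝ), sq_nonneg (k 1 : ℝ)]
  · simp only [Fin.mk_one]; nlinarith [sq_nonneg (k 0 : ℝ), sq_nonneg (k 1 : ℝ)]

lemma summable_freq_rpow {s : ℝ} (hs : 2 < s) :
    Summable fun k : Fin 2 → ℤ => freq k ^ (-s) := by
  refine (EisensteinSeries.summable_one_div_norm_rpow hs).of_nonneg_of_le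
    (fun k => Real.rpow_nonneg (freq_nonneg k) _) fun k => ?_
  rcases eq_or_ne k 0 with rfl | hk
  · simp [freq_zero]
  · exact Real.rpow_le_rpow_of_nonpos (norm_pos_iff.2 hk) (norm_le_freq k) (by linarith)

/-- The weight `1 + |2πk|`. -/
def wt (k : Fin 2 → ℤ) : ℝ := 1 + freq k

lemma one_le_wt (k : Fin 2 → ℤ) : 1 ≤ wt k := by linarith [freq_nonneg k, wt.eq_1 k]

lemma wt_pos (k : Fin 2 → ℤ) : 0 < wt k := by linarith [one_le_wt k]

lemma freq_le_wt (k : Fin 2 → ℤ) : freq k ≤ wt k := by simp [wt]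

lemma wt_add_le (k l : Fin 2 → ℤ) : wt (k + l) ≤ wt k * wt l := by
  have := freq_add_le k l
  have := mul_nonneg (freq_nonneg k) (freq_nonneg l)
  unfold wt; nlinarith

lemma summable_wt_rpow {s : ℝ} (hs : 2 < s) :
    Summable fun k : Fin 2 → ℤ => wt k ^ (-s) := by
  refine (EisensteinSeries.summable_one_div_norm_rpow hs).of_norm_bounded_eventually ?_
  have : ∀ᶠ k : Fin 2 → ℤ in cofinite, k ≠ 0 := by
    simp [Filter.eventually_cofinite]
  filter_upwards [this] with k hk
  rw [Real.norm_of_nonneg (Real.rpow_nonneg (wt_pos k).le _)]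
  exact Real.rpow_le_rpow_of_nonpos (norm_pos_iff.2 hk)
    ((norm_le_freq k).trans (freq_le_wt k)) (by linarith)

/-! ### The sequence space of H³ coefficients -/

/-- Square summability of a sequence with three derivatives. -/
def SeqH3 (a : (Fin 2 → ℤ) → ℂ) : Prop := Summable fun k => wt k ^ 6 * ‖a k‖ ^ 2

/-- The squared norm associated with `SeqH3`. -/
def sqH3 (a : (Fin 2 → ℤ) → ℂ) : ℝ := ∑' k, wt k ^ 6 * ‖a k‖ ^ 2

lemma wt_pow_le (k : Fin 2 → ℤ) : wt k ^ 6 ≤ 8 * (1 + freq k ^ 2) ^ (3 : ℝ) := by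
  rw [show (3 : ℝ) = ((3 : ℕ) : ℝ) by norm_num, Real.rpow_natCast]
  have : wt k ^ 2 ≤ 2 * (1 + freq k ^ 2) := by unfold wt; nlinarith [sq_nonneg (freq k - 1)]
  calc wt k ^ 6 = (wt k ^ 2) ^ 3 := by ring
    _ ≤ (2 * (1 + freq k ^ 2)) ^ 3 := by gcongr
    _ = _ := by ring

lemma MemHs.seqH3 {g : T2 → ℝ} (hg : MemHs 3 g) : SeqH3 (coeff g) := by
  refine (hg.2.mul_left 8).of_nonneg_of_le (fun k => by have := wt_pos k; positivity) fun k => ?_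
  rw [← mul_assoc]
  exact mul_le_mul_of_nonneg_right (wt_pow_le k) (sq_nonneg _)

lemma MemHs.sqH3_le {g : T2 → ℝ} (hg : MemHs 3 g) : sqH3 (coeff g) ≤ 8 * hNorm 3 g ^ 2 := by
  rw [hNorm, Real.sq_sqrt (tsum_nonneg fun k => by positivity), ← tsum_mul_left]
  refine hg.seqH3.tsum_le_tsum (fun k => ?_) (hg.2.mul_left 8)
  rw [← mul_assoc]
  exact mul_le_mul_of_nonneg_right (wt_pow_le k) (sq_nonneg _)

lemma SeqH3.summable_wt_mul {a : (Fin 2 → ℤ) → ℂ} (ha : SeqH3 a) :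
    Summable fun k => wt k * ‖a k‖ := by
  have h4 := summable_wt_rpow (s := 4) (by norm_num)
  refine (ha.add h4).of_nonneg_of_le (fun k => by have := wt_pos k; positivity) fun k => ?_
  have hp := wt_pos k
  rw [Real.rpow_neg hp.le, show (4 : ℝ) = ((4 : ℕ) : ℝ) by norm_num, Real.rpow_natCast]
  have : wt k * ‖a k‖ = (wt k ^ 3 * ‖a k‖) * (wt k ^ 2)⁻¹ := by field_simp
  rw [this]
  have e1 : wt k ^ 6 * ‖a k‖ ^ 2 = (wt k ^ 3 * ‖a k‖) ^ 2 := by ring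
  have e2 : (wt k ^ 4)⁻¹ = ((wt k ^ 2)⁻¹) ^ 2 := by rw [← inv_pow, ← inv_pow, ← pow_mul]
  rw [e1, e2]
  nlinarith [sq_nonneg (wt k ^ 3 * ‖a k‖ - (wt k ^ 2)⁻¹),
    sq_nonneg (wt k ^ 3 * ‖a k‖), sq_nonneg ((wt k ^ 2)⁻¹)]

lemma SeqH3.summable_multiplier {m a : (Fin 2 → ℤ) → ℂ} (ha : SeqH3 a)
    (hm : ∀ k, ‖m k‖ ≤ wt k) : Summable fun k => ‖m k * a k‖ :=
  ha.summable_wt_mul.of_nonneg_of_le (fun _ => norm_nonneg _) fun k => by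
    rw [norm_mul]; exact mul_le_mul_of_nonneg_right (hm k) (norm_nonneg _)

/-! ### The equation on the Fourier side -/

/-- The symbol of `∂ⱼ`. -/
def symD (j : Fin 2) (k : Fin 2 → ℤ) : ℂ := 2 * Real.pi * Complex.I * (k j : ℂ)

/-- The symbol of `Rⱼ`. -/
def symR (j : Fin 2) (k : Fin 2 → ℤ) : ℂ := 2 * Real.pi * Complex.I * (k j : ℂ) / (freq k : ℂ)

lemma norm_symD_le (j : Fin 2) (k : Fin 2 → ℤ) : ‖symD j k‖ ≤ freq k := by
  have h : ‖symD j k‖ = 2 * Real.pi * |(k j : ℝ)| := by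
    simp [symD, abs_of_pos Real.pi_pos]
  rw [h]
  apply le_of_sq_le_sq _ (freq_nonneg k)
  rw [freq_sq, mul_pow, sq_abs]
  gcongr
  fin_cases j <;> simp <;> positivity

lemma norm_symR_le (j : Fin 2) (k : Fin 2 → ℤ) : ‖symR j k‖ ≤ 1 := by
  have : symR j k = symD j k / (freq k : ℂ) := rfl
  rw [this, norm_div, Complex.norm_real, Real.norm_of_nonneg (freq_nonneg k)]
  exact div_le_one_of_le₀ (norm_symD_le j k) (freq_nonneg k)

lemma isHermitian_symD (j : Fin 2) : IsHermitian (symD j) := by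
  intro k; simp [symD, map_ofNat]

lemma isHermitian_symR (j : Fin 2) : IsHermitian (symR j) := by
  intro k; simp [symR, freq_neg, map_ofNat]

/-- The Fourier side of the transport term. -/
def advect (a b : (Fin 2 → ℤ) → ℂ) (n : Fin 2 → ℤ) : ℂ :=
  ∑' k, ((cross k (n - k) / freq k : ℝ) : ℂ) * a k * b (n - k)

lemma continuous_partialDeriv {h : T2 → ℝ} (hh : MemHs 3 h) (j : Fin 2) :
    Continuous (partialDeriv j h) :=
  continuous_multiplier (m := symD j) (hh.seqH3.summable_multiplier fun k =>
    (norm_symD_le j k).trans (freq_le_wt k))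

lemma summable_symR {g : T2 → ℝ} (hg : MemHs 3 g) (j : Fin 2) :
    Summable fun k => ‖symR j k * coeff g k‖ :=
  hg.seqH3.summable_multiplier fun k => (norm_symR_le j k).trans (one_le_wt k)

lemma summable_symR_mul {g h : T2 → ℝ} (hg : MemHs 3 g) (hh : MemHs 3 h) (i j : Fin 2)
    (n : Fin 2 → ℤ) :
    Summable fun k => symR i k * coeff g k * (symD j (n - k) * coeff h (n - k)) := by
  have h1 := summable_symR hg i
  have h2 := hh.seqH3.summable_multiplier (m := symD j) fun k =>
    (norm_symD_le j k).trans (freq_le_wt k)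
  refine Summable.of_norm ?_
  refine (h1.mul_right (∑' k, ‖symD j k * coeff h k‖)).of_nonneg_of_le
    (fun _ => norm_nonneg _) fun k => ?_
  rw [norm_mul]
  exact mul_le_mul_of_nonneg_left
    (h2.le_tsum (n - k) fun _ _ => norm_nonneg _) (norm_nonneg _)

lemma coeff_riesz_mul_partialDeriv {g h : T2 → ℝ} (hg : MemHs 3 g) (hh : MemHs 3 h)
    (i j : Fin 2) (n : Fin 2 → ℤ) :
    coeff (fun x => riesz i g x * partialDeriv j h x) n
      = ∑' k, symR i k * coeff g k * (symD j (n - k) * coeff h (n - k)) := by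
  have h2 := hh.seqH3.summable_multiplier (m := symD j) fun k =>
    (norm_symD_le j k).trans (freq_le_wt k)
  refine (coeff_multiplier_mul (isHermitian_symR i) (summable_symR hg i)
    (continuous_partialDeriv hh j) n).trans ?_
  congr 1; ext k
  rw [show coeff (partialDeriv j h) (n - k) = _ from
    coeff_multiplier (isHermitian_symD j) h2 (n - k)]

lemma integrable_real {G : T2 → ℝ} (hG : Continuous G) : Integrable G haarT2 :=
  hG.integrable_of_hasCompactSupport (HasCompactSupport.of_compactSpace G)

lemma continuous_riesz {g : T2 → ℝ} (hg : MemHs 3 g) (j : Fin 2) : Continuous (riesz j g) :=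
  continuous_multiplier (m := symR j) (summable_symR hg j)

lemma continuous_transport {g h : T2 → ℝ} (hg : MemHs 3 g) (hh : MemHs 3 h) :
    Continuous (transport g h) :=
  ((continuous_riesz hg 1).mul (continuous_partialDeriv hh 0)).add
    ((continuous_riesz hg 0).neg.mul (continuous_partialDeriv hh 1))

/-- The two products of Riesz and derivative symbols combine, with I² = -1, into the cross product
over the length of the first frequency. This antisymmetric form is what all later cancellations use.
-/
lemma coeff_transport {g h : T2 → ℝ} (hg : MemHs 3 g) (hh : MemHs 3 h) (n : Fin 2 → ℤ) :
    coeff (transport g h) n = advect (coeff g) (coeff h) n := by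
  have e : transport g h = fun x => riesz 1 g x * partialDeriv 0 h x
      - riesz 0 g x * partialDeriv 1 h x := by
    ext x; unfold transport; ring
  rw [e, coeff_sub (g := fun x => riesz 1 g x * partialDeriv 0 h x)
      (h := fun x => riesz 0 g x * partialDeriv 1 h x)
      (integrable_real ((continuous_riesz hg 1).mul (continuous_partialDeriv hh 0)))
      (integrable_real ((continuous_riesz hg 0).mul (continuous_partialDeriv hh 1))),
    coeff_riesz_mul_partialDeriv hg hh, coeff_riesz_mul_partialDeriv hg hh,
    ← (summable_symR_mul hg hh 1 0 n).tsum_sub (summable_symR_mul hg hh 0 1 n), advect]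
  congr 1; ext k
  simp only [symR, symD, cross]
  push_cast
  ring_nf
  simp only [Complex.I_sq]
  ring

lemma freq_rpow_le_wt {γ : ℝ} (hγ0 : 0 < γ) (hγ1 : γ < 1) (k : Fin 2 → ℤ) :
    freq k ^ γ ≤ wt k :=
  calc freq k ^ γ ≤ wt k ^ γ := Real.rpow_le_rpow (freq_nonneg k) (freq_le_wt k) hγ0.le
    _ ≤ wt k ^ (1 : ℝ) := Real.rpow_le_rpow_of_exponent_le (one_le_wt k) hγ1.le
    _ = wt k := Real.rpow_one _

lemma coeff_rhs {γ : ℝ} (hγ0 : 0 < γ) (hγ1 : γ < 1) {Θ₀ θ : T2 → ℝ} (hΘ : MemHs 3 Θ₀)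
    (hθ : MemHs 3 θ) (n : Fin 2 → ℤ) :
    coeff (fun x => linearized γ Θ₀ θ x + nonlinearity θ x) n =
      -advect (coeff Θ₀) (coeff θ) n - advect (coeff θ) (coeff Θ₀) n
        - (freq n ^ γ : ℝ) * coeff θ n - advect (coeff θ) (coeff θ) n := by
  have hm : IsHermitian fun k => ((freq k ^ γ : ℝ) : ℂ) := by intro k; simp [freq_neg]
  have hs : Summable fun k => ‖((freq k ^ γ : ℝ) : ℂ) * coeff θ k‖ :=
    hθ.seqH3.summable_multiplier fun k => by
      rw [Complex.norm_real, Real.norm_of_nonneg (Real.rpow_nonneg (freq_nonneg k) _)]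
      exact freq_rpow_le_wt hγ0 hγ1 k
  have hL : Continuous (fracLap γ θ) := continuous_multiplier hs
  have h1 := continuous_transport hΘ hθ
  have h2 := continuous_transport hθ hΘ
  have h3 := continuous_transport hθ hθ
  simp only [linearized, nonlinearity, ← sub_eq_add_neg]
  rw [coeff_sub (integrable_real (by fun_prop)) (integrable_real h3),
    coeff_sub (integrable_real (by fun_prop)) (integrable_real hL),
    coeff_sub (integrable_real (by fun_prop)) (integrable_real h2),
    coeff_neg_fun]
  change -coeff (transport Θ₀ θ) n - coeff (transport θ Θ₀) n - coeff (fracLap γ θ) n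
    - coeff (transport θ θ) n = _
  rw [coeff_transport hΘ hθ, coeff_transport hθ hΘ, coeff_transport hθ hθ,
    show coeff (fracLap γ θ) n = _ from coeff_multiplier hm hs n]

/-! ### Absolute convergence of the trilinear sums -/

lemma advect_term_le (a b : (Fin 2 → ℤ) → ℂ) (n k : Fin 2 → ℤ) :
    wt n ^ 2 * (wt (n - k) * ‖a k‖ * ‖b (n - k)‖)
      ≤ wt k ^ 6 * ‖a k‖ ^ 2 + wt (n - k) ^ 6 * ‖b (n - k)‖ ^ 2 := by
  have h1 := wt_add_le k (n - k)
  rw [add_sub_cancel] at h1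
  have hk := one_le_wt k
  have hl := wt_pos (n - k)
  have hn := wt_pos n
  calc wt n ^ 2 * (wt (n - k) * ‖a k‖ * ‖b (n - k)‖)
      ≤ (wt k * wt (n - k)) ^ 2 * (wt (n - k) * ‖a k‖ * ‖b (n - k)‖) := by gcongr
    _ = wt k ^ 2 * ‖a k‖ * (wt (n - k) ^ 3 * ‖b (n - k)‖) := by ring
    _ ≤ wt k ^ 3 * ‖a k‖ * (wt (n - k) ^ 3 * ‖b (n - k)‖) := by
        gcongr
        norm_num
    _ ≤ _ := by
        nlinarith [sq_nonneg (wt k ^ 3 * ‖a k‖ - wt (n - k) ^ 3 * ‖b (n - k)‖),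
          sq_nonneg (wt k ^ 3 * ‖a k‖), sq_nonneg (wt (n - k) ^ 3 * ‖b (n - k)‖)]

lemma summable_advect_abs {a b : (Fin 2 → ℤ) → ℂ} (ha : SeqH3 a) (hb : SeqH3 b)
    (n : Fin 2 → ℤ) : Summable fun k => wt (n - k) * ‖a k‖ * ‖b (n - k)‖ := by
  have hb' : Summable fun k => wt (n - k) ^ 6 * ‖b (n - k)‖ ^ 2 :=
    (Equiv.subLeft n).summable_iff.2 hb
  have h := (ha.add hb').of_nonneg_of_le (fun k => by
    have := wt_pos (n - k); have := wt_pos n; positivity) (advect_term_le a b n)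
  exact (summable_mul_left_iff (pow_ne_zero 2 (wt_pos n).ne')).1 h

/-- Submultiplicativity of `wt` moves the two weights at n onto k and n - k. With the derivative on
b, neither factor carries more than three. The outcome is only a pointwise bound in n, but it is
enough for every pairing with r < 4. -/
lemma tsum_advect_abs_le {a b : (Fin 2 → ℤ) → ℂ} (ha : SeqH3 a) (hb : SeqH3 b)
    (n : Fin 2 → ℤ) :
    wt n ^ 2 * ∑' k, wt (n - k) * ‖a k‖ * ‖b (n - k)‖ ≤ sqH3 a + sqH3 b := by
  have hb' : Summable fun k => wt (n - k) ^ 6 * ‖b (n - k)‖ ^ 2 :=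
    (Equiv.subLeft n).summable_iff.2 hb
  have hs : ∑' k, wt (n - k) ^ 6 * ‖b (n - k)‖ ^ 2 = sqH3 b :=
    (Equiv.subLeft n).tsum_eq fun k => wt k ^ 6 * ‖b k‖ ^ 2
  rw [← tsum_mul_left, ← hs, sqH3, ← ha.tsum_add hb']
  exact ((summable_advect_abs ha hb n).mul_left _).tsum_le_tsum (advect_term_le a b n)
    (ha.add hb')

lemma abs_cross_div_le (k l : Fin 2 → ℤ) : |cross k l / freq k| ≤ freq l := by
  rw [abs_div, abs_of_nonneg (freq_nonneg k)]
  exact div_le_of_le_mul₀ (freq_nonneg k) (freq_nonneg l)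
    ((abs_cross_le k l).trans_eq (mul_comm _ _))

lemma norm_advect_term_le (a b : (Fin 2 → ℤ) → ℂ) (n k : Fin 2 → ℤ) :
    ‖((cross k (n - k) / freq k : ℝ) : ℂ) * a k * b (n - k)‖
      ≤ wt (n - k) * ‖a k‖ * ‖b (n - k)‖ := by
  rw [norm_mul, norm_mul, Complex.norm_real, Real.norm_eq_abs]
  gcongr
  exact (abs_cross_div_le _ _).trans (freq_le_wt _)

lemma norm_advect_le {a b : (Fin 2 → ℤ) → ℂ} (ha : SeqH3 a) (hb : SeqH3 b)
    (n : Fin 2 → ℤ) : wt n ^ 2 * ‖advect a b n‖ ≤ sqH3 a + sqH3 b := by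
  refine le_trans ?_ (tsum_advect_abs_le ha hb n)
  refine mul_le_mul_of_nonneg_left ?_ (sq_nonneg _)
  exact tsum_of_norm_bounded (summable_advect_abs ha hb n).hasSum (norm_advect_term_le a b n)

/-- A weighted Young inequality, the termwise form of Cauchy-Schwarz for `∑ wt^{r-2} |a|`. -/
lemma wt_rpow_mul_le {r : ℝ} {ε M x : ℝ} (hε : 0 < ε) (k : Fin 2 → ℤ) :
    wt k ^ (r - 2) * x * M ≤ ε * (wt k ^ 6 * x ^ 2) + ε⁻¹ * (M ^ 2 * wt k ^ (-(10 - 2 * r))) := by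
  have hp := wt_pos k
  have e1 : wt k ^ (-(10 - 2 * r)) = (wt k ^ (r - 5)) ^ 2 := by
    rw [← Real.rpow_natCast, ← Real.rpow_mul hp.le]; congr 1; push_cast; ring
  have e2 : wt k ^ (r - 2) = wt k ^ (r - 5) * wt k ^ 3 := by
    rw [← Real.rpow_natCast, ← Real.rpow_add hp]; congr 1; push_cast; ring
  rw [e1, e2]
  set y := wt k ^ (r - 5)
  have h : 0 ≤ ε⁻¹ * (ε * (wt k ^ 3 * x) - M * y) ^ 2 := by positivity
  have h' : ε⁻¹ * (ε * (wt k ^ 3 * x) - M * y) ^ 2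
      = ε * (wt k ^ 6 * x ^ 2) - 2 * (y * wt k ^ 3 * x * M) + ε⁻¹ * (M ^ 2 * y ^ 2) := by
    field_simp; ring
  have h2 : 0 ≤ ε * (wt k ^ 6 * x ^ 2) + ε⁻¹ * (M ^ 2 * y ^ 2) := by positivity
  linarith

lemma summable_wt_rpow_mul {r : ℝ} (hr : r < 4) {a : (Fin 2 → ℤ) → ℂ} (ha : SeqH3 a) :
    Summable fun k => wt k ^ (r - 2) * ‖a k‖ := by
  have hu := summable_wt_rpow (s := 10 - 2 * r) (by linarith)
  refine (ha.add hu).of_nonneg_of_le (fun k => mul_nonneg (Real.rpow_nonneg (wt_pos k).le _)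
    (norm_nonneg _)) fun k => ?_
  simpa using wt_rpow_mul_le (r := r) (ε := 1) (M := 1) (x := ‖a k‖) one_pos k

/-- The equivalence `(n, k) ↦ (k, n - k)` of the lattice of pairs. -/
def pairEquiv : (Fin 2 → ℤ) × (Fin 2 → ℤ) ≃ (Fin 2 → ℤ) × (Fin 2 → ℤ) where
  toFun z := (z.2, z.1 - z.2)
  invFun z := (z.1 + z.2, z.1)
  left_inv z := by simp
  right_inv z := by simp

/-- The terms of the trilinear form `∑ₙ |2πn|^r conj(c n) (advect a b) n`. -/
def triTerm (r : ℝ) (a b c : (Fin 2 → ℤ) → ℂ) (z : (Fin 2 → ℤ) × (Fin 2 → ℤ)) : ℂ :=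
  ((freq (z.1 + z.2) ^ r * (cross z.1 z.2 / freq z.1) : ℝ) : ℂ)
    * (a z.1 * b z.2 * conj (c (z.1 + z.2)))

lemma freq_rpow_le_wt_rpow {r : ℝ} (hr : 0 ≤ r) (k : Fin 2 → ℤ) : freq k ^ r ≤ wt k ^ r :=
  Real.rpow_le_rpow (freq_nonneg k) (freq_le_wt k) hr

/-- Since the convolution decays like `wt`⁻², it remains to sum `wt`^(r-2) times the norm of c.
Cauchy-Schwarz against three derivatives needs 10 - 2r > 2, which is the origin of the condition r <
4. -/
lemma triTerm_summable_aux {r : ℝ} (hr0 : 0 ≤ r) (hr : r < 4) {a b c : (Fin 2 → ℤ) → ℂ}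
    (ha : SeqH3 a) (hb : SeqH3 b) (hc : SeqH3 c) :
    Summable (triTerm r a b c ∘ pairEquiv) := by
  have hS : Summable fun z : (Fin 2 → ℤ) × (Fin 2 → ℤ) =>
      wt z.1 ^ r * ‖c z.1‖ * (wt (z.1 - z.2) * ‖a z.2‖ * ‖b (z.1 - z.2)‖) := by
    have hnn : ∀ z : (Fin 2 → ℤ) × (Fin 2 → ℤ),
        0 ≤ wt z.1 ^ r * ‖c z.1‖ * (wt (z.1 - z.2) * ‖a z.2‖ * ‖b (z.1 - z.2)‖) := fun z =>
      mul_nonneg (mul_nonneg (Real.rpow_nonneg (wt_pos _).le _) (norm_nonneg _))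
        (mul_nonneg (mul_nonneg (wt_pos _).le (norm_nonneg _)) (norm_nonneg _))
    refine (summable_prod_of_nonneg hnn).2 ⟨fun n => ?_, ?_⟩
    · exact Summable.mul_left (wt n ^ r * ‖c n‖) (summable_advect_abs ha hb n)
    simp only [tsum_mul_left]
    refine ((summable_wt_rpow_mul hr hc).mul_right (sqH3 a + sqH3 b)).of_nonneg_of_le
      (fun n => ?_) fun n => ?_
    · exact mul_nonneg (mul_nonneg (Real.rpow_nonneg (wt_pos _).le _) (norm_nonneg _))
        (tsum_nonneg fun k => mul_nonneg (mul_nonneg (wt_pos _).le (norm_nonneg _)) (norm_nonneg _))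
    · have hp := wt_pos n
      have e : wt n ^ r = wt n ^ (r - 2) * wt n ^ 2 := by
        rw [← Real.rpow_natCast, ← Real.rpow_add hp]; congr 1; push_cast; ring
      have := tsum_advect_abs_le ha hb n
      calc _ = wt n ^ (r - 2) * ‖c n‖
            * (wt n ^ 2 * ∑' k, wt (n - k) * ‖a k‖ * ‖b (n - k)‖) := by rw [e]; ring
        _ ≤ _ := by gcongr
  refine Summable.of_norm (hS.of_nonneg_of_le (fun _ => norm_nonneg _) fun z => ?_)
  simp only [Function.comp, triTerm, pairEquiv, Equiv.coe_fn_mk, add_sub_cancel]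
  have h1 := norm_advect_term_le a b z.1 z.2
  have h2 := freq_rpow_le_wt_rpow hr0 z.1
  have h3 := Real.rpow_nonneg (freq_nonneg z.1) r
  have h4 := wt_pos z.1
  calc _ = freq z.1 ^ r * ‖c z.1‖ *
        ‖((cross z.2 (z.1 - z.2) / freq z.2 : ℝ) : ℂ) * a z.2 * b (z.1 - z.2)‖ := by
        simp only [norm_mul, Complex.norm_real, RCLike.norm_conj, Real.norm_eq_abs,
          abs_of_nonneg h3]
        ring
    _ ≤ _ := by gcongr

lemma summable_triTerm {r : ℝ} (hr0 : 0 ≤ r) (hr : r < 4) {a b c : (Fin 2 → ℤ) → ℂ}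
    (ha : SeqH3 a) (hb : SeqH3 b) (hc : SeqH3 c) : Summable (triTerm r a b c) :=
  pairEquiv.summable_iff.1 (triTerm_summable_aux hr0 hr ha hb hc)

lemma hasSum_advect_pairing {r : ℝ} (hr0 : 0 ≤ r) (hr : r < 4) {a b c : (Fin 2 → ℤ) → ℂ}
    (ha : SeqH3 a) (hb : SeqH3 b) (hc : SeqH3 c) :
    HasSum (fun n => ((freq n ^ r : ℝ) : ℂ) * (conj (c n) * advect a b n))
      (∑' z, triTerm r a b c z) := by
  have h := triTerm_summable_aux hr0 hr ha hb hc
  have h2 := (pairEquiv.hasSum_iff.2 (summable_triTerm hr0 hr ha hb hc).hasSum).prod_fiberwise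
    (g := fun n => ((freq n ^ r : ℝ) : ℂ) * (conj (c n) * advect a b n)) ?_
  · exact h2
  intro n
  have hs : Summable fun k => ((cross k (n - k) / freq k : ℝ) : ℂ) * a k * b (n - k) :=
    Summable.of_norm ((summable_advect_abs ha hb n).of_nonneg_of_le (fun _ => norm_nonneg _)
      (norm_advect_term_le a b n))
  have h3 := (hs.hasSum.mul_left (conj (c n))).mul_left ((freq n ^ r : ℝ) : ℂ)
  refine h3.congr_fun fun k => ?_
  simp only [Function.comp, triTerm, pairEquiv, Equiv.coe_fn_mk, add_sub_cancel]
  push_cast; ring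

/-! ### The energy and its time derivative -/

/-- The homogeneous energy `∑ |2πk|^r |a k|²`. -/
def energy (r : ℝ) (a : (Fin 2 → ℤ) → ℂ) : ℝ := ∑' k, freq k ^ r * ‖a k‖ ^ 2

lemma energy_term_nonneg (r : ℝ) (a : (Fin 2 → ℤ) → ℂ) (k : Fin 2 → ℤ) :
    0 ≤ freq k ^ r * ‖a k‖ ^ 2 :=
  mul_nonneg (Real.rpow_nonneg (freq_nonneg k) _) (sq_nonneg _)

lemma energy_nonneg (r : ℝ) (a : (Fin 2 → ℤ) → ℂ) : 0 ≤ energy r a :=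
  tsum_nonneg (energy_term_nonneg r a)

lemma SeqH3.summable_energy {r : ℝ} (hr0 : 0 ≤ r) (hr : r ≤ 6) {a : (Fin 2 → ℤ) → ℂ}
    (ha : SeqH3 a) : Summable fun k => freq k ^ r * ‖a k‖ ^ 2 := by
  refine ha.of_nonneg_of_le (energy_term_nonneg r a) fun k => ?_
  gcongr
  calc freq k ^ r ≤ wt k ^ r := freq_rpow_le_wt_rpow hr0 k
    _ ≤ wt k ^ ((6 : ℕ) : ℝ) := Real.rpow_le_rpow_of_exponent_le (one_le_wt k) (by simpa using hr)
    _ = wt k ^ 6 := Real.rpow_natCast _ _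

/-- A series of functions converges uniformly if each Cauchy-Schwarz type majorant has a
uniformly bounded first part and a uniformly summable second part. -/
lemma tendstoUniformlyOnFilter_of_le {ι : Type*} {l : Filter ℝ} {g A : ℝ → ι → ℝ} {u : ι → ℝ}
    {B : ℝ} (hu : Summable u) (hA0 : ∀ τ k, 0 ≤ A τ k)
    (hA : ∀ᶠ τ in l, Summable (A τ) ∧ ∑' k, A τ k ≤ B)
    (hg : ∀ᶠ τ in l, ∀ ε : ℝ, 0 < ε → ∀ k, |g τ k| ≤ ε * A τ k + ε⁻¹ * u k) :
    TendstoUniformlyOnFilter (fun (F : Finset ι) τ => ∑ k ∈ F, g τ k)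
      (fun τ => ∑' k, g τ k) atTop l := by
  rw [Metric.tendstoUniformlyOnFilter_iff]
  intro δ hδ
  -- First ε makes the bounded part at most δ/2, uniformly in τ; with ε fixed, the tail of u makes
  -- up the other half.
  set ε := δ / (2 * (|B| + 1)) with hε
  have hB : 0 < |B| + 1 := by positivity
  have hε0 : 0 < ε := by positivity
  have ht := tendsto_tsum_compl_atTop_zero u
  have hF : ∀ᶠ F : Finset ι in atTop, ε⁻¹ * ∑' k : { x // x ∉ F }, u k < δ / 2 := by
    have := ht.const_mul ε⁻¹
    rw [mul_zero] at this
    exact this.eventually_lt_const (by positivity)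
  filter_upwards [hF.prod_mk (hA.and hg)] with p hp
  obtain ⟨F, τ⟩ := p
  obtain ⟨hp1, ⟨hAs, hAB⟩, hgb⟩ := hp
  simp only at hp1 hAs hAB hgb ⊢
  have hgs : Summable (g τ) := by
    refine Summable.of_norm (((hAs.mul_left 1).add (hu.mul_left 1⁻¹)).of_nonneg_of_le
      (fun _ => norm_nonneg _) fun k => hgb 1 one_pos k)
  rw [dist_eq_norm, ← hgs.sum_add_tsum_subtype_compl F, add_sub_cancel_left]
  have hAc : Summable fun k : { x // x ∉ F } => A τ k := hAs.subtype {x | x ∉ F}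
  have huc : Summable fun k : { x // x ∉ F } => u k := hu.subtype {x | x ∉ F}
  have h1 : ‖∑' k : { x // x ∉ F }, g τ k‖
      ≤ ε * ∑' k : { x // x ∉ F }, A τ k + ε⁻¹ * ∑' k : { x // x ∉ F }, u k := by
    rw [← tsum_mul_left, ← tsum_mul_left]
    rw [← Summable.tsum_add (hAc.mul_left ε) (huc.mul_left ε⁻¹)]
    exact tsum_of_norm_bounded ((hAc.mul_left ε).add (huc.mul_left ε⁻¹)).hasSum
      fun k => hgb ε hε0 k
  have h2 : ∑' k : { x // x ∉ F }, A τ k ≤ |B| :=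
    (hAs.tsum_subtype_le _ {x | x ∉ F} (hA0 τ)).trans (hAB.trans (le_abs_self B))
  have h3 : ε * |B| ≤ δ / 2 := by
    rw [hε, div_mul_eq_mul_div, div_le_div_iff₀ (by positivity) (by positivity)]
    nlinarith
  calc _ ≤ _ := h1
    _ ≤ ε * |B| + ε⁻¹ * ∑' k : { x // x ∉ F }, u k := by gcongr
    _ < δ := by linarith

/-- The series may be differentiated term by term because the differentiated series converges
uniformly near t. Its terms obey the weighted Young inequality, with the local H³ bound as bounded
part and the summable weights `wt`^(-(10-2r)) as tail. -/
lemma hasDerivAt_energy {r : ℝ} (hr0 : 0 ≤ r) (hr : r < 4) {a a' : ℝ → (Fin 2 → ℤ) → ℂ}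
    {t B M : ℝ} (ha : ∀ᶠ τ in 𝓝 t, SeqH3 (a τ) ∧ sqH3 (a τ) ≤ B)
    (hd : ∀ᶠ τ in 𝓝 t, ∀ k, HasDerivAt (fun s => a s k) (a' τ k) τ)
    (hM : ∀ᶠ τ in 𝓝 t, ∀ k, wt k ^ 2 * ‖a' τ k‖ ≤ M) :
    HasDerivAt (fun τ => energy r (a τ))
      (∑' k, freq k ^ r * (2 * (conj (a t k) * a' t k).re)) t := by
  have hu := (summable_wt_rpow (s := 10 - 2 * r) (by linarith)).mul_left ((2 * M) ^ 2)
  refine hasDerivAt_of_tendstoUniformlyOnFilter (l := (atTop : Filter (Finset (Fin 2 → ℤ))))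
    (f := fun F τ => ∑ k ∈ F, freq k ^ r * ‖a τ k‖ ^ 2)
    (f' := fun F τ => ∑ k ∈ F, freq k ^ r * (2 * (conj (a τ k) * a' τ k).re))
    (g' := fun τ => ∑' k, freq k ^ r * (2 * (conj (a τ k) * a' τ k).re)) ?_ ?_ ?_
  · refine tendstoUniformlyOnFilter_of_le (A := fun τ k => wt k ^ 6 * ‖a τ k‖ ^ 2) (B := B) hu
      (fun τ k => mul_nonneg (pow_nonneg (wt_pos k).le _) (sq_nonneg _)) ha ?_
    filter_upwards [hM] with τ hτ ε hε k
    refine le_trans ?_ (wt_rpow_mul_le (r := r) (M := 2 * M) hε k)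
    have hp := wt_pos k
    have e : wt k ^ r = wt k ^ (r - 2) * wt k ^ 2 := by
      rw [← Real.rpow_natCast, ← Real.rpow_add hp]; congr 1; push_cast; ring
    have h1 := Real.rpow_nonneg (freq_nonneg k) r
    have h2 : |(conj (a τ k) * a' τ k).re| ≤ ‖a τ k‖ * ‖a' τ k‖ :=
      (Complex.abs_re_le_norm _).trans_eq (by rw [norm_mul, RCLike.norm_conj])
    have h3 := freq_rpow_le_wt_rpow hr0 k
    calc _ = freq k ^ r * (2 * |(conj (a τ k) * a' τ k).re|) := by
          rw [abs_mul, abs_mul, abs_of_nonneg h1, abs_two]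
      _ ≤ wt k ^ r * (2 * (‖a τ k‖ * ‖a' τ k‖)) := by gcongr
      _ = wt k ^ (r - 2) * ‖a τ k‖ * (2 * (wt k ^ 2 * ‖a' τ k‖)) := by rw [e]; ring
      _ ≤ _ := by gcongr; exact hτ k
  · rw [eventually_prod_iff]
    refine ⟨fun _ => True, Eventually.of_forall fun _ => trivial, _, hd, ?_⟩
    intro F _ τ hτ
    refine HasDerivAt.fun_sum fun k _ => ?_
    have h := (hτ k).norm_sq.const_mul (freq k ^ r)
    simpa [Complex.inner, mul_comm] using h
  · filter_upwards [ha] with τ hτ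
    exact (hτ.1.summable_energy hr0 (by linarith)).hasSum

/-! ### The low-frequency sum -/

lemma sum_range_rpow_le {γ : ℝ} (hγ0 : 0 < γ) (hγ1 : γ < 1) (N : ℕ) :
    ∑ j ∈ Finset.range N, (1 + (j : ℝ)) ^ (γ - 1) ≤ (N : ℝ) ^ γ / γ := by
  induction N with
  | zero => simp [hγ0.ne']
  | succ N ih =>
    rw [Finset.sum_range_succ]
    have hp : (0 : ℝ) < 1 + N := by positivity
    -- Bernoulli's inequality for concave powers gives γ(1+N)^(γ-1) ≤ (1+N)^γ - N^γ, so the sum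
    -- telescopes.
    have h := rpow_one_add_le_one_add_mul_self (s := -(1 / (1 + (N : ℝ))))
      (neg_le_neg ((div_le_one hp).2 (by linarith [Nat.cast_nonneg (α := ℝ) N]))) hγ0.le hγ1.le
    have e : 1 + -(1 / (1 + (N : ℝ))) = N / (1 + N) := by field_simp; ring
    rw [e, Real.div_rpow (Nat.cast_nonneg N) hp.le, div_le_iff₀ (Real.rpow_pos_of_pos hp _)] at h
    have e2 : (1 + (N : ℝ)) ^ (γ - 1) = (1 + (N : ℝ)) ^ γ * (1 / (1 + N)) := by
      rw [Real.rpow_sub_one hp.ne']; ring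
    have key : γ * (1 + (N : ℝ)) ^ (γ - 1) ≤ (1 + (N : ℝ)) ^ γ - (N : ℝ) ^ γ := by
      rw [e2]; nlinarith
    have : (1 + (N : ℝ)) ^ (γ - 1) ≤ ((1 + (N : ℝ)) ^ γ - (N : ℝ) ^ γ) / γ := by
      rw [le_div_iff₀ hγ0]; linarith
    push_cast
    rw [add_comm (N : ℝ) 1]
    calc _ ≤ (N : ℝ) ^ γ / γ + ((1 + (N : ℝ)) ^ γ - (N : ℝ) ^ γ) / γ := add_le_add ih this
      _ = _ := by ring

lemma sum_Icc_rpow_le {γ : ℝ} (hγ0 : 0 < γ) (hγ1 : γ < 1) (N : ℕ) :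
    ∑ j ∈ Finset.Icc (-(N : ℤ)) N, (1 + |(j : ℝ)|) ^ (γ - 1) ≤ 2 * (((N : ℝ) + 1) ^ γ / γ) := by
  have h := sum_range_rpow_le hγ0 hγ1 (N + 1)
  push_cast at h
  have hsub : Finset.Icc (-(N : ℤ)) N ⊆ (Finset.range (N + 1)).image (fun j : ℕ => (j : ℤ))
      ∪ (Finset.range (N + 1)).image (fun j : ℕ => -(j : ℤ)) := by
    intro j hj
    simp only [Finset.mem_Icc, Finset.mem_union, Finset.mem_image, Finset.mem_range] at hj ⊢
    rcases le_total 0 j with h0 | h0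
    · exact Or.inl ⟨j.toNat, by omega, by omega⟩
    · exact Or.inr ⟨(-j).toNat, by omega, by omega⟩
  have hnn : ∀ j : ℤ, 0 ≤ (1 + |(j : ℝ)|) ^ (γ - 1) := fun j => by positivity
  calc _ ≤ _ := Finset.sum_le_sum_of_subset_of_nonneg hsub fun j _ _ => hnn j
    _ ≤ ∑ j ∈ (Finset.range (N + 1)).image (fun j : ℕ => (j : ℤ)), (1 + |(j : ℝ)|) ^ (γ - 1)
        + ∑ j ∈ (Finset.range (N + 1)).image (fun j : ℕ => -(j : ℤ)),
          (1 + |(j : ℝ)|) ^ (γ - 1) := by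
        rw [← Finset.sum_union_inter]
        exact le_add_of_nonneg_right (Finset.sum_nonneg fun j _ => hnn j)
    _ = ∑ j ∈ Finset.range (N + 1), (1 + (j : ℝ)) ^ (γ - 1)
        + ∑ j ∈ Finset.range (N + 1), (1 + (j : ℝ)) ^ (γ - 1) := by
        rw [Finset.sum_image (fun a _ b _ h => by simpa using h),
          Finset.sum_image (fun a _ b _ h => by simpa using h)]
        simp
    _ ≤ _ := by linarith

/-- A nonzero frequency satisfies |ξ|² ≥ (1+|k₀|)(1+|k₁|), and the exponent γ - 1 is negative. The
product form reduces sums over boxes to one dimension. -/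
lemma freq_rpow_le_prod {γ : ℝ} (hγ1 : γ < 1) {k : Fin 2 → ℤ} (hk : k ≠ 0) :
    freq k ^ (2 * (γ - 1)) ≤ ∏ i, (1 + |(k i : ℝ)|) ^ (γ - 1) := by
  rw [Fin.prod_univ_two, ← Real.mul_rpow (by positivity) (by positivity),
    Real.rpow_mul (freq_nonneg k)]
  refine Real.rpow_le_rpow_of_nonpos (by positivity) ?_ (by linarith)
  rw [show (2 : ℝ) = ((2 : ℕ) : ℝ) by norm_num, Real.rpow_natCast, freq_sq]
  have h1 := one_le_sq_add_sq hk
  have habs : ∀ j : ℤ, |(j : ℝ)| ≤ (j : ℝ) ^ 2 := fun j => by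
    rw [← sq_abs]
    have : |j| ≤ |j| ^ 2 := by
      rcases eq_or_ne j 0 with rfl | hj
      · simp
      · have := Int.one_le_abs hj; nlinarith
    exact_mod_cast this
  have := habs (k 0)
  have := habs (k 1)
  have h2 := two_pi_sq_ge
  have : |(k 0 : ℝ)| * |(k 1 : ℝ)| ≤ ((k 0 : ℝ) ^ 2 + (k 1 : ℝ) ^ 2) / 2 := by
    nlinarith [sq_nonneg (|(k 0 : ℝ)| - |(k 1 : ℝ)|), sq_abs (k 0 : ℝ), sq_abs (k 1 : ℝ)]
  nlinarith

/-- The lattice points in the ball of radius `R`, contained in a finite box. -/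
lemma mem_box_of_freq_le {R : ℝ} {k : Fin 2 → ℤ} (hk : freq k ≤ R) :
    k ∈ Fintype.piFinset fun _ : Fin 2 => Finset.Icc (-((⌊R⌋₊ : ℕ) : ℤ)) (⌊R⌋₊ : ℕ) := by
  rw [Fintype.mem_piFinset]
  intro i
  have h : |(k i : ℝ)| ≤ R := by
    have := (norm_le_pi_norm k i).trans ((norm_le_freq k).trans hk)
    rwa [Int.norm_eq_abs] at this
  have h2 : (k i).natAbs ≤ ⌊R⌋₊ := by
    apply Nat.le_floor
    rwa [Nat.cast_natAbs, Int.cast_abs]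
  rw [Finset.mem_Icc]
  omega

/-- Cauchy-Schwarz after writing |ξ| = |ξ|^(γ-1) |ξ|^(2-γ). In two dimensions the squares of the
first factor sum to order R^(2γ) over the ball; the second factor gives the critical energy. -/
lemma sum_low_freq_le {γ : ℝ} (hγ0 : 0 < γ) (hγ1 : γ < 1) {a : (Fin 2 → ℤ) → ℂ}
    (ha : SeqH3 a) {R : ℝ} (hR0 : 0 ≤ R) :
    ∑' k, (if freq k ≤ R then freq k * ‖a k‖ else 0)
      ≤ 4 / γ * R ^ γ * Real.sqrt (energy (2 * (2 - γ)) a) := by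
  set S := Fintype.piFinset fun _ : Fin 2 => Finset.Icc (-((⌊R⌋₊ : ℕ) : ℤ)) (⌊R⌋₊ : ℕ) with hS
  have h0 : ∀ k ∉ S, (if freq k ≤ R then freq k * ‖a k‖ else 0) = 0 := fun k hk =>
    if_neg fun h => hk (mem_box_of_freq_le h)
  rw [tsum_eq_sum h0]
  -- Below radius 1 only the zero frequency occurs, and it contributes nothing. For R ≥ 1 the box
  -- size ⌊R⌋ + 1 is at most 2R.
  rcases lt_or_ge R 1 with hR | hR
  · have hz : ∀ k ∈ S, (if freq k ≤ R then freq k * ‖a k‖ else 0) = 0 := by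
      intro k _
      split_ifs with h
      · have : k = 0 := by
          by_contra hk; linarith [one_le_freq hk]
        rw [this, freq_zero, zero_mul]
      · rfl
    rw [Finset.sum_eq_zero hz]
    have := Real.rpow_nonneg hR0 γ
    positivity
  set u : (Fin 2 → ℤ) → ℝ := fun k => if k = 0 then 0 else freq k ^ (γ - 1)
  set v : (Fin 2 → ℤ) → ℝ := fun k => freq k ^ (2 - γ) * ‖a k‖
  have h1 : ∑ k ∈ S, (if freq k ≤ R then freq k * ‖a k‖ else 0) ≤ ∑ k ∈ S, u k * v k := by
    refine Finset.sum_le_sum fun k _ => ?_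
    simp only [u, v]
    rcases eq_or_ne k 0 with rfl | hk
    · simp [freq_zero]
    · have hf := freq_pos hk
      rw [if_neg hk, ← mul_assoc, ← Real.rpow_add hf,
        show γ - 1 + (2 - γ) = 1 by ring, Real.rpow_one]
      split_ifs
      · exact le_rfl
      · positivity
  have hu : ∑ k ∈ S, u k ^ 2 ≤ (4 / γ * R ^ γ) ^ 2 := by
    have hu1 : ∀ k ∈ S, u k ^ 2 ≤ ∏ i, (1 + |(k i : ℝ)|) ^ (γ - 1) := by
      intro k _
      simp only [u]
      split_ifs with hk
      · rw [zero_pow two_ne_zero]; exact Finset.prod_nonneg fun i _ => by positivity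
      · refine le_of_eq_of_le ?_ (freq_rpow_le_prod hγ1 hk)
        rw [← Real.rpow_natCast, ← Real.rpow_mul (freq_nonneg k)]; congr 1; push_cast; ring
    refine (Finset.sum_le_sum hu1).trans ?_
    rw [hS, Finset.sum_prod_piFinset
      (Finset.Icc (-((⌊R⌋₊ : ℕ) : ℤ)) (⌊R⌋₊ : ℕ)) fun _ j => (1 + |(j : ℝ)|) ^ (γ - 1),
      Finset.prod_const, Finset.card_univ, Fintype.card_fin]
    refine pow_le_pow_left₀ (Finset.sum_nonneg fun j _ => by positivity) ?_ 2
    refine (sum_Icc_rpow_le hγ0 hγ1 _).trans ?_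
    have hfl := Nat.floor_le (by linarith : 0 ≤ R)
    have : ((⌊R⌋₊ : ℝ) + 1) ^ γ ≤ 2 * R ^ γ :=
      calc ((⌊R⌋₊ : ℝ) + 1) ^ γ ≤ (2 * R) ^ γ :=
            Real.rpow_le_rpow (by positivity) (by linarith) hγ0.le
        _ = 2 ^ γ * R ^ γ := Real.mul_rpow (by norm_num) (by linarith)
        _ ≤ 2 ^ (1 : ℝ) * R ^ γ := by gcongr; norm_num
        _ = _ := by rw [Real.rpow_one]
    calc 2 * (((⌊R⌋₊ : ℝ) + 1) ^ γ / γ) ≤ 2 * (2 * R ^ γ / γ) := by gcongr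
      _ = _ := by ring
  have hv : ∑ k ∈ S, v k ^ 2 ≤ energy (2 * (2 - γ)) a := by
    refine le_of_eq_of_le (Finset.sum_congr rfl fun k _ => ?_)
      ((ha.summable_energy (by linarith) (by linarith)).sum_le_tsum S
        fun k _ => energy_term_nonneg _ _ _)
    simp only [v]
    rw [mul_pow, ← Real.rpow_natCast, ← Real.rpow_mul (freq_nonneg k)]
    congr 2; push_cast; ring
  refine h1.trans ((Real.sum_mul_le_sqrt_mul_sqrt S u v).trans ?_)
  gcongr
  refine (Real.sqrt_le_sqrt hu).trans (Real.sqrt_sq ?_).le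
  have := Real.rpow_nonneg (by linarith : 0 ≤ R) γ
  positivity

/-! ### The symmetrized symbol of the cubic term -/

/-- The mean value inequality for real powers. -/
lemma rpow_sub_rpow_le {s b c : ℝ} (hs : 1 ≤ s) (hb : 0 ≤ b) (hc : 0 < c) :
    c ^ s - b ^ s ≤ s * c ^ (s - 1) * (c - b) := by
  have h := one_add_mul_self_le_rpow_one_add (s := b / c - 1)
    (by linarith [div_nonneg hb hc.le]) hs
  rw [add_sub_cancel, Real.div_rpow hb hc.le, le_div_iff₀ (Real.rpow_pos_of_pos hc _)] at h
  rw [Real.rpow_sub_one hc.ne']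
  have : s * (c ^ s / c) * (c - b) = c ^ s - (1 + s * (b / c - 1)) * c ^ s := by
    field_simp; ring
  linarith

/-- The contribution of a triple of frequencies whose first entry is the smallest. -/
def minTerm (r a b c : ℝ) : ℝ := if a ≤ b ∧ a ≤ c then a * (b ^ (r / 2) * c ^ (r / 2)) else 0

lemma minTerm_nonneg {r a b c : ℝ} (ha : 0 ≤ a) (hb : 0 ≤ b) (hc : 0 ≤ c) :
    0 ≤ minTerm r a b c := by
  unfold minTerm; split_ifs
  · positivity
  · exact le_rfl

lemma minTerm_swap (r a b c : ℝ) : minTerm r a c b = minTerm r a b c := by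
  simp only [minTerm, mul_comm (c ^ (r / 2)), and_comm]

/-- The symmetrized symbol of the trilinear form, apart from the factor `cross`. -/
def symBracket (r a b c : ℝ) : ℝ :=
  c ^ r * (1 / a - 1 / b) + b ^ r * (1 / c - 1 / a) + a ^ r * (1 / b - 1 / c)

lemma symBracket_swap (r a b c : ℝ) : symBracket r b a c = -symBracket r a b c := by
  unfold symBracket; ring

lemma symBracket_rot (r a b c : ℝ) : symBracket r b c a = symBracket r a b c := by
  unfold symBracket; ring

/-- Over the common denominator abc the bracket is a difference of two nonnegative products, each at
most 5abc^r, since c - b ≤ a by the triangle inequality. The factor X, at most ab in size, removes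
the remaining singularity. -/
lemma symBracket_le_of_sorted {r a b c X : ℝ} (hr0 : 0 ≤ r) (hr : r ≤ 4) (ha : 0 < a)
    (hab : a ≤ b) (hbc : b ≤ c) (hc : c ≤ a + b) (hX : |X| ≤ a * b) :
    |X * symBracket r a b c| ≤ 20 * minTerm r a b c := by
  have hb : 0 < b := by linarith
  have hc0 : 0 < c := by linarith
  have hcr := Real.rpow_pos_of_pos hc0 r
  have p1 : ∀ x : ℝ, 0 < x → x ^ (r + 1) = x ^ r * x := fun x hx => by
    rw [Real.rpow_add hx, Real.rpow_one]
  have e : symBracket r a b c = ((b - a) * (c ^ (r + 1) - b ^ (r + 1))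
      - (c - b) * (b ^ (r + 1) - a ^ (r + 1))) / (a * b * c) := by
    rw [p1 a ha, p1 b hb, p1 c hc0, symBracket]
    field_simp
    ring
  have m1 : 0 ≤ c ^ (r + 1) - b ^ (r + 1) :=
    sub_nonneg.2 (Real.rpow_le_rpow hb.le hbc (by linarith))
  have m2 : 0 ≤ b ^ (r + 1) - a ^ (r + 1) :=
    sub_nonneg.2 (Real.rpow_le_rpow ha.le hab (by linarith))
  have g1 : (b - a) * (c ^ (r + 1) - b ^ (r + 1)) ≤ 5 * (a * b * c ^ r) := by
    have h := rpow_sub_rpow_le (s := r + 1) (by linarith) hb.le hc0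
    rw [add_sub_cancel_right] at h
    have h2 : (r + 1) * c ^ r * (c - b) ≤ 5 * c ^ r * a := by
      apply mul_le_mul _ (by linarith) (by linarith) (by positivity)
      gcongr; linarith
    calc _ ≤ b * (5 * c ^ r * a) := by
          apply mul_le_mul (by linarith) (h.trans h2) m1 hb.le
      _ = _ := by ring
  have g2 : (c - b) * (b ^ (r + 1) - a ^ (r + 1)) ≤ 5 * (a * b * c ^ r) := by
    have h : b ^ (r + 1) - a ^ (r + 1) ≤ c ^ r * b := by
      have := Real.rpow_nonneg ha.le (r + 1)
      have h3 : b ^ r ≤ c ^ r := Real.rpow_le_rpow hb.le hbc hr0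
      rw [p1 b hb]
      nlinarith
    calc _ ≤ a * (c ^ r * b) := mul_le_mul (by linarith) h m2 ha.le
      _ ≤ _ := by nlinarith [mul_pos (mul_pos ha hb) hcr]
  have hB : |symBracket r a b c| ≤ 5 * c ^ r / c := by
    rw [e, abs_div, abs_of_pos (by positivity : 0 < a * b * c), div_le_div_iff₀ (by positivity) hc0]
    have h5 : |(b - a) * (c ^ (r + 1) - b ^ (r + 1)) - (c - b) * (b ^ (r + 1) - a ^ (r + 1))|
        ≤ 5 * (a * b * c ^ r) := by
      have q1 : 0 ≤ (b - a) * (c ^ (r + 1) - b ^ (r + 1)) := mul_nonneg (by linarith) m1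
      have q2 : 0 ≤ (c - b) * (b ^ (r + 1) - a ^ (r + 1)) := mul_nonneg (by linarith) m2
      rw [abs_le]; constructor <;> linarith
    calc _ ≤ 5 * (a * b * c ^ r) * c := by gcongr
      _ = _ := by ring
  have hch : c ^ (r / 2) ≤ 4 * b ^ (r / 2) :=
    calc c ^ (r / 2) ≤ (2 * b) ^ (r / 2) := Real.rpow_le_rpow hc0.le (by linarith) (by linarith)
      _ = 2 ^ (r / 2) * b ^ (r / 2) := Real.mul_rpow (by norm_num) hb.le
      _ ≤ 2 ^ (2 : ℝ) * b ^ (r / 2) := by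
          gcongr
          · norm_num
          · linarith
      _ = _ := by norm_num
  have hcc : c ^ r = c ^ (r / 2) * c ^ (r / 2) := by rw [← Real.rpow_add hc0]; ring_nf
  have hch0 := Real.rpow_pos_of_pos hc0 (r / 2)
  rw [minTerm, if_pos ⟨hab, hab.trans hbc⟩, abs_mul]
  calc |X| * |symBracket r a b c| ≤ (a * b) * (5 * c ^ r / c) :=
        mul_le_mul hX hB (abs_nonneg _) (by positivity)
    _ ≤ (a * c) * (5 * c ^ r / c) := by gcongr
    _ = 5 * a * (c ^ (r / 2) * c ^ (r / 2)) := by rw [hcc]; field_simp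
    _ ≤ 5 * a * ((4 * b ^ (r / 2)) * c ^ (r / 2)) := by gcongr
    _ = _ := by ring

lemma symBracket_le {r a b c X : ℝ} (hr0 : 0 ≤ r) (hr : r ≤ 4) (ha : 0 ≤ a) (hb : 0 ≤ b)
    (hc : 0 ≤ c) (habc : a ≤ b + c) (hbca : b ≤ c + a) (hcab : c ≤ a + b)
    (hX1 : |X| ≤ a * b) (hX2 : |X| ≤ b * c) (hX3 : |X| ≤ c * a) :
    |X * symBracket r a b c| ≤ 20 * (minTerm r a b c + minTerm r b c a + minTerm r c a b) := by
  have n1 := minTerm_nonneg (r := r) ha hb hc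
  have n2 := minTerm_nonneg (r := r) hb hc ha
  have n3 := minTerm_nonneg (r := r) hc ha hb
  rcases ha.eq_or_lt with rfl | ha
  · have : X = 0 := by simpa using hX1
    subst this; simp; linarith
  rcases hb.eq_or_lt with rfl | hb
  · have : X = 0 := by simpa using hX1
    subst this; simp; linarith
  rcases hc.eq_or_lt with rfl | hc
  · have : X = 0 := by simpa using hX2
    subst this; simp; linarith
  have perm : ∀ {x y z}, 0 < x → x ≤ y → y ≤ z → z ≤ x + y → |X| ≤ x * y →
      |symBracket r x y z| = |symBracket r a b c| →
      |X * symBracket r a b c| ≤ 20 * minTerm r x y z := by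
    intro x y z h1 h2 h3 h4 h5 h6
    rw [abs_mul, ← h6, ← abs_mul]
    exact symBracket_le_of_sorted hr0 hr h1 h2 h3 h4 h5
  have e1 : |symBracket r a c b| = |symBracket r a b c| := by
    rw [← symBracket_rot, symBracket_swap, abs_neg, ← symBracket_rot, ← symBracket_rot]
  have e2 : |symBracket r b a c| = |symBracket r a b c| := by rw [symBracket_swap, abs_neg]
  have e3 : |symBracket r c b a| = |symBracket r a b c| := by
    rw [symBracket_swap, abs_neg, symBracket_rot]
  have e4 : |symBracket r b c a| = |symBracket r a b c| := by rw [symBracket_rot]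
  have e5 : |symBracket r c a b| = |symBracket r a b c| := by
    rw [symBracket_rot, symBracket_rot]
  have s1 := minTerm_swap r a b c
  have s2 := minTerm_swap r b c a
  have s3 := minTerm_swap r c a b
  rcases le_total a b with h1 | h1
  · rcases le_total b c with h2 | h2
    · linarith [perm ha h1 h2 hcab hX1 rfl]
    · rcases le_total a c with h3 | h3
      · linarith [perm ha h3 h2 (by linarith) (by linarith) e1]
      · linarith [perm hc h3 h1 (by linarith) hX3 e5]
  · rcases le_total a c with h2 | h2
    · linarith [perm hb h1 h2 (by linarith) (by linarith) e2]
    · rcases le_total b c with h3 | h3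
      · linarith [perm hb h3 h2 (by linarith) hX2 e4]
      · linarith [perm hc h3 h1 (by linarith) (by linarith) e3]

/-! ### Symmetrization and the critical estimate of the cubic term -/

/-- The sequence consists of the Fourier coefficients of a real function. -/
def IsReal (a : (Fin 2 → ℤ) → ℂ) : Prop := ∀ k, a (-k) = conj (a k)

lemma IsReal.norm_neg {a : (Fin 2 → ℤ) → ℂ} (ha : IsReal a) (k : Fin 2 → ℤ) :
    ‖a (-k)‖ = ‖a k‖ := by rw [ha, RCLike.norm_conj]

/-- The cyclic permutation of triples of frequencies with sum zero. -/
def rotEquiv : (Fin 2 → ℤ) × (Fin 2 → ℤ) ≃ (Fin 2 → ℤ) × (Fin 2 → ℤ) where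
  toFun z := (z.2, -(z.1 + z.2))
  invFun z := (-(z.1 + z.2), z.1)
  left_inv z := by ext <;> simp
  right_inv z := by ext <;> simp

/-- The transposition of pairs. -/
def swapEquiv : (Fin 2 → ℤ) × (Fin 2 → ℤ) ≃ (Fin 2 → ℤ) × (Fin 2 → ℤ) := Equiv.prodComm _ _

/-- The six summands are f at the ordered pairs drawn from the triple k, l, -(k+l). Each arises from
f by a bijection of the lattice of pairs, hence has the same sum. -/
lemma hasSum_symmetrize {M : Type*} [AddCommMonoid M] [TopologicalSpace M] [ContinuousAdd M]
    {f : (Fin 2 → ℤ) × (Fin 2 → ℤ) → M} {S : M} (h : HasSum f S) :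
    HasSum (fun z : (Fin 2 → ℤ) × (Fin 2 → ℤ) =>
      (f (z.1, z.2) + f (z.2, -(z.1 + z.2)) + f (-(z.1 + z.2), z.1))
      + (f (z.2, z.1) + f (-(z.1 + z.2), z.2) + f (z.1, -(z.1 + z.2))))
      ((S + S + S) + (S + S + S)) := by
  have h1 := rotEquiv.hasSum_iff.2 h
  have h2 := rotEquiv.symm.hasSum_iff.2 h
  have h' := swapEquiv.hasSum_iff.2 h
  have h3 := rotEquiv.hasSum_iff.2 h'
  have h4 := rotEquiv.symm.hasSum_iff.2 h'
  exact ((h.add h1).add h2).add ((h'.add h3).add h4)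

/-- For a real function the amplitude product is the same for all six orderings, and the cross
product changes only its sign. What remains is the alternating sum of |k+l|^r/|k| over the
orderings. -/
lemma sum_triTerm_perm {r : ℝ} {a : (Fin 2 → ℤ) → ℂ} (ha : IsReal a)
    (z : (Fin 2 → ℤ) × (Fin 2 → ℤ)) :
    (triTerm r a a a (z.1, z.2) + triTerm r a a a (z.2, -(z.1 + z.2))
        + triTerm r a a a (-(z.1 + z.2), z.1))
      + (triTerm r a a a (z.2, z.1) + triTerm r a a a (-(z.1 + z.2), z.2)
        + triTerm r a a a (z.1, -(z.1 + z.2)))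
      = ((cross z.1 z.2 * symBracket r (freq z.1) (freq z.2) (freq (z.1 + z.2)) : ℝ) : ℂ)
        * (a z.1 * a z.2 * conj (a (z.1 + z.2))) := by
  obtain ⟨k, l⟩ := z
  have c2 : cross (-(k + l)) k = cross k l := by simp [cross]; ring
  have c3 : cross (-(k + l)) l = -cross k l := by simp [cross]; ring
  have c4 : cross l k = -cross k l := cross_comm k l
  have s1 : l + -(k + l) = -k := by abel
  have s2 : -(k + l) + k = -l := by abel
  have s3 : -(k + l) + l = -k := by abel
  have s4 : k + -(k + l) = -l := by abel
  have hk : conj (a (-k)) = a k := by rw [ha, Complex.conj_conj]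
  have hl : conj (a (-l)) = a l := by rw [ha, Complex.conj_conj]
  simp only [triTerm, cross_add_neg, cross_neg_add, c2, c3, c4, s1, s2, s3, s4, hk, hl,
    ha (k + l), freq_neg, symBracket, add_comm l k]
  push_cast
  ring

/-- The majorant of the symmetrized trilinear form. -/
def triMajorant (r : ℝ) (a : (Fin 2 → ℤ) → ℂ) (z : (Fin 2 → ℤ) × (Fin 2 → ℤ)) : ℝ :=
  (if freq z.1 ≤ freq z.2 then freq z.1 * ‖a z.1‖ else 0) * (freq z.2 ^ r * ‖a z.2‖ ^ 2)

lemma triMajorant_nonneg (r : ℝ) (a : (Fin 2 → ℤ) → ℂ) (z : (Fin 2 → ℤ) × (Fin 2 → ℤ)) :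
    0 ≤ triMajorant r a z := by
  refine mul_nonneg ?_ (energy_term_nonneg r a z.2)
  split_ifs
  · exact mul_nonneg (freq_nonneg _) (norm_nonneg _)
  · exact le_rfl

lemma SeqH3.summable_freq_mul {a : (Fin 2 → ℤ) → ℂ} (ha : SeqH3 a) :
    Summable fun k => freq k * ‖a k‖ :=
  ha.summable_wt_mul.of_nonneg_of_le (fun k => mul_nonneg (freq_nonneg k) (norm_nonneg _))
    fun k => mul_le_mul_of_nonneg_right (freq_le_wt k) (norm_nonneg _)

/-- Summing over the lower frequency first costs |l|^γ times the critical norm, which is exactly the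
gain of the dissipation. -/
lemma triMajorant_hasSum {γ r : ℝ} (hγ0 : 0 < γ) (hγ1 : γ < 1) (hr0 : 0 < r) (hr : r < 4)
    {a : (Fin 2 → ℤ) → ℂ} (ha : SeqH3 a) :
    ∃ S, HasSum (triMajorant r a) S ∧
      S ≤ 4 / γ * Real.sqrt (energy (2 * (2 - γ)) a) * energy (r + γ) a := by
  have hlow : ∀ l : Fin 2 → ℤ,
      Summable fun k => if freq k ≤ freq l then freq k * ‖a k‖ else 0 := fun l =>
    ha.summable_freq_mul.of_nonneg_of_le
      (fun k => by
        split_ifs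
        · exact mul_nonneg (freq_nonneg _) (norm_nonneg _)
        · exact le_rfl)
      (fun k => by
        split_ifs
        · exact le_rfl
        · exact mul_nonneg (freq_nonneg _) (norm_nonneg _))
  have hE := ha.summable_energy (r := r + γ) (by linarith) (by linarith)
  set A := 4 / γ * Real.sqrt (energy (2 * (2 - γ)) a) with hA
  have hin : ∀ l : Fin 2 → ℤ, ∑' k, triMajorant r a (k, l)
      ≤ A * (freq l ^ (r + γ) * ‖a l‖ ^ 2) := by
    intro l
    simp only [triMajorant]
    rw [tsum_mul_right, Real.rpow_add_of_nonneg (freq_nonneg l) hr0.le hγ0.le]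
    calc _ ≤ (4 / γ * freq l ^ γ * Real.sqrt (energy (2 * (2 - γ)) a))
          * (freq l ^ r * ‖a l‖ ^ 2) := by
          refine mul_le_mul_of_nonneg_right ?_ (energy_term_nonneg r a l)
          exact sum_low_freq_le hγ0 hγ1 ha (freq_nonneg l)
      _ = _ := by rw [hA]; ring
  have hs : Summable (triMajorant r a ∘ swapEquiv) := by
    refine (summable_prod_of_nonneg fun z => triMajorant_nonneg r a _).2 ⟨fun l => ?_, ?_⟩
    · exact (hlow l).mul_right (freq l ^ r * ‖a l‖ ^ 2)
    · exact (hE.mul_left A).of_nonneg_of_le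
        (fun l => tsum_nonneg fun k => triMajorant_nonneg r a _) hin
  refine ⟨_, (swapEquiv.summable_iff.1 hs).hasSum, ?_⟩
  rw [← swapEquiv.tsum_eq, show ∑' z, triMajorant r a (swapEquiv z) = _ from hs.tsum_prod, energy, ← tsum_mul_left]
  exact Summable.tsum_le_tsum hin
    ((summable_prod_of_nonneg fun z => triMajorant_nonneg r a _).1 hs).2 (hE.mul_left A)

lemma minTerm_mul_le {r a b c x y w : ℝ} (ha : 0 ≤ a) (hb : 0 ≤ b)
    (hc : 0 ≤ c) (hx : 0 ≤ x) :
    minTerm r a b c * (x * y * w)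
      ≤ ((if a ≤ b then a * x else 0) * (b ^ r * y ^ 2)
        + (if a ≤ c then a * x else 0) * (c ^ r * w ^ 2)) / 2 := by
  have hb2 : b ^ r = (b ^ (r / 2)) ^ 2 := by
    rw [← Real.rpow_natCast, ← Real.rpow_mul hb]; congr 1; push_cast; ring
  have hc2 : c ^ r = (c ^ (r / 2)) ^ 2 := by
    rw [← Real.rpow_natCast, ← Real.rpow_mul hc]; congr 1; push_cast; ring
  have hax : 0 ≤ a * x := mul_nonneg ha hx
  unfold minTerm
  by_cases h : a ≤ b ∧ a ≤ c
  · rw [if_pos h, if_pos h.1, if_pos h.2, hb2, hc2]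
    nlinarith [mul_nonneg hax (sq_nonneg (b ^ (r / 2) * y - c ^ (r / 2) * w))]
  · rw [if_neg h, zero_mul]
    have : 0 ≤ b ^ r * y ^ 2 := by positivity
    have : 0 ≤ c ^ r * w ^ 2 := by positivity
    split_ifs <;> positivity

lemma freq_triangle (k l : Fin 2 → ℤ) : freq k ≤ freq l + freq (k + l) := by
  have := freq_add_le (-l) (k + l)
  rwa [freq_neg, show -l + (k + l) = k by abel] at this

lemma abs_cross_le_left (k l : Fin 2 → ℤ) : |cross k l| ≤ freq k * freq (k + l) := by
  have := abs_cross_le k (-(k + l))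
  rwa [cross_neg_add, abs_neg, freq_neg] at this

lemma abs_cross_le_right (k l : Fin 2 → ℤ) : |cross k l| ≤ freq l * freq (k + l) := by
  have := abs_cross_le l (-(k + l))
  rwa [cross_add_neg, freq_neg] at this

/-- The critical estimate of the nonlinear term. -/
lemma norm_tri_le {γ r : ℝ} (hγ0 : 0 < γ) (hγ1 : γ < 1) (hr0 : 0 < r) (hr : r < 4)
    {a : (Fin 2 → ℤ) → ℂ} (ha : SeqH3 a) (hre : IsReal a) :
    ‖∑' z, triTerm r a a a z‖
      ≤ 40 / γ * Real.sqrt (energy (2 * (2 - γ)) a) * energy (r + γ) a := by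
  obtain ⟨J, hJ, hJle⟩ := triMajorant_hasSum hγ0 hγ1 hr0 hr ha
  have hT := hasSum_symmetrize (summable_triTerm hr0.le hr ha ha ha).hasSum
  simp only [sum_triTerm_perm hre] at hT
  -- The factor 10 is 20 from the symbol bound, halved by the arithmetic-geometric mean in
  -- `minTerm_mul_le`. The six copies on both sides cancel.
  have hJ6 := (hasSum_symmetrize hJ).mul_left 10
  have hb := tsum_of_norm_bounded hJ6 (f := fun z : (Fin 2 → ℤ) × (Fin 2 → ℤ) =>
    ((cross z.1 z.2 * symBracket r (freq z.1) (freq z.2) (freq (z.1 + z.2)) : ℝ) : ℂ)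
        * (a z.1 * a z.2 * conj (a (z.1 + z.2)))) ?_
  · rw [hT.tsum_eq] at hb
    set S := ∑' z, triTerm r a a a z
    have e : S + S + S + (S + S + S) = ((6 : ℝ) : ℂ) * S := by push_cast; ring
    rw [e, norm_mul, Complex.norm_real] at hb
    norm_num at hb
    calc ‖S‖ ≤ 10 * J := by linarith
      _ ≤ 10 * (4 / γ * Real.sqrt (energy (2 * (2 - γ)) a) * energy (r + γ) a) := by gcongr
      _ = _ := by ring
  · rintro ⟨k, l⟩
    dsimp only
    have hk := freq_nonneg k
    have hl := freq_nonneg l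
    have hm := freq_nonneg (k + l)
    have t1 := freq_triangle k l
    have t2 := freq_triangle l k
    rw [add_comm l k] at t2
    have t3 := freq_add_le k l
    have hB := symBracket_le (r := r) (X := cross k l) hr0.le hr.le hk hl hm t1 (by linarith) t3
      (abs_cross_le k l) (abs_cross_le_right k l)
      ((abs_cross_le_left k l).trans_eq (mul_comm _ _))
    have nk := norm_nonneg (a k)
    have nl := norm_nonneg (a l)
    have nm := norm_nonneg (a (k + l))
    have m1 := minTerm_mul_le (r := r) (y := ‖a l‖) (w := ‖a (k + l)‖) hk hl hm nk
    have m2 := minTerm_mul_le (r := r) (y := ‖a (k + l)‖) (w := ‖a k‖) hl hm hk nl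
    have m3 := minTerm_mul_le (r := r) (y := ‖a k‖) (w := ‖a l‖) hm hk hl nm
    rw [norm_mul, Complex.norm_real, Real.norm_eq_abs, norm_mul, norm_mul, RCLike.norm_conj]
    simp only [triMajorant, freq_neg, hre.norm_neg]
    calc _ ≤ 20 * (minTerm r (freq k) (freq l) (freq (k + l))
          + minTerm r (freq l) (freq (k + l)) (freq k)
          + minTerm r (freq (k + l)) (freq k) (freq l)) * (‖a k‖ * ‖a l‖ * ‖a (k + l)‖) := by
          gcongr
      _ = 20 * (minTerm r (freq k) (freq l) (freq (k + l)) * (‖a k‖ * ‖a l‖ * ‖a (k + l)‖)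
          + minTerm r (freq l) (freq (k + l)) (freq k) * (‖a l‖ * ‖a (k + l)‖ * ‖a k‖)
          + minTerm r (freq (k + l)) (freq k) (freq l) * (‖a (k + l)‖ * ‖a k‖ * ‖a l‖)) := by ring
      _ ≤ _ := by linarith

/-! ### The terms linear in the perturbation -/

/-- The shear `(k, l) ↦ (k, k + l)`. -/
def shearEquiv : (Fin 2 → ℤ) × (Fin 2 → ℤ) ≃ (Fin 2 → ℤ) × (Fin 2 → ℤ) where
  toFun z := (z.1, z.1 + z.2)
  invFun z := (z.1, z.2 - z.1)
  left_inv z := by simp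
  right_inv z := by simp

lemma hasSum_mul_fst_snd {f g : (Fin 2 → ℤ) → ℝ} (hf : Summable f) (hg : Summable g)
    (hf0 : ∀ k, 0 ≤ f k) (hg0 : ∀ k, 0 ≤ g k) :
    HasSum (fun z : (Fin 2 → ℤ) × (Fin 2 → ℤ) => f z.1 * g z.2) ((∑' k, f k) * ∑' k, g k) :=
  hf.hasSum.mul hg.hasSum (hf.mul_of_nonneg hg hf0 hg0)

lemma hasSum_mul_fst_add {f g : (Fin 2 → ℤ) → ℝ} (hf : Summable f) (hg : Summable g)
    (hf0 : ∀ k, 0 ≤ f k) (hg0 : ∀ k, 0 ≤ g k) :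
    HasSum (fun z : (Fin 2 → ℤ) × (Fin 2 → ℤ) => f z.1 * g (z.1 + z.2))
      ((∑' k, f k) * ∑' k, g k) :=
  shearEquiv.hasSum_iff.2 (hasSum_mul_fst_snd hf hg hf0 hg0)

lemma hasSum_mul_snd_add {f g : (Fin 2 → ℤ) → ℝ} (hf : Summable f) (hg : Summable g)
    (hf0 : ∀ k, 0 ≤ f k) (hg0 : ∀ k, 0 ≤ g k) :
    HasSum (fun z : (Fin 2 → ℤ) × (Fin 2 → ℤ) => f z.2 * g (z.1 + z.2))
      ((∑' k, f k) * ∑' k, g k) := by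
  refine (swapEquiv.hasSum_iff.2 (hasSum_mul_fst_add hf hg hf0 hg0)).congr_fun fun z => ?_
  simp [swapEquiv, add_comm]

/-- The majorant of the linear terms. The first index belongs to the coefficient. -/
def linMajorant (r : ℝ) (b a : (Fin 2 → ℤ) → ℂ) (z : (Fin 2 → ℤ) × (Fin 2 → ℤ)) : ℝ :=
  (freq z.1 * ‖b z.1‖ + freq z.1 ^ (r + 2) * ‖b z.1‖ ^ 2) *
      (freq z.2 ^ r * ‖a z.2‖ ^ 2)
    + (freq z.1 * ‖b z.1‖ + freq z.1 ^ (r + 2) * ‖b z.1‖ ^ 2) *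
      (freq (z.1 + z.2) ^ r * ‖a (z.1 + z.2)‖ ^ 2)
    + (freq z.2 ^ (-r) * (freq (z.1 + z.2) ^ r * ‖a (z.1 + z.2)‖ ^ 2)
      + freq z.2 ^ r * ‖a z.2‖ ^ 2 * freq (z.1 + z.2) ^ (-r))

/-- The constant in the estimate of the linear terms with coefficient `b`. -/
def linConst (r : ℝ) (b : (Fin 2 → ℤ) → ℂ) : ℝ :=
  (∑' k, (freq k * ‖b k‖ + freq k ^ (r + 2) * ‖b k‖ ^ 2)) + ∑' k : Fin 2 → ℤ, freq k ^ (-r)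

lemma linMajorant_nonneg (r : ℝ) (b a : (Fin 2 → ℤ) → ℂ) (z : (Fin 2 → ℤ) × (Fin 2 → ℤ)) :
    0 ≤ linMajorant r b a z := by
  have h1 := freq_nonneg z.1
  have h2 := freq_nonneg z.2
  have h3 := freq_nonneg (z.1 + z.2)
  unfold linMajorant
  positivity

lemma linConst_nonneg (r : ℝ) (b : (Fin 2 → ℤ) → ℂ) : 0 ≤ linConst r b :=
  add_nonneg
    (tsum_nonneg fun k => add_nonneg (mul_nonneg (freq_nonneg k) (norm_nonneg _))
      (energy_term_nonneg _ b k))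
    (tsum_nonneg fun k => Real.rpow_nonneg (freq_nonneg k) _)

/-- Any two of k, l, k+l are independent lattice variables, so every product splits into two sums.
Finiteness of ∑ |ξ|^(-r) needs r > 2; at frequency zero this power is 0 by convention. The
coefficient needs (r+2)/2 < 3 derivatives. -/
lemma linMajorant_hasSum {r : ℝ} (hr2 : 2 < r) (hr : r < 4) {b a : (Fin 2 → ℤ) → ℂ}
    (hb : SeqH3 b) (ha : SeqH3 a) :
    HasSum (linMajorant r b a) (2 * linConst r b * energy r a) := by
  have h1 := hb.summable_freq_mul.add (hb.summable_energy (r := r + 2) (by linarith) (by linarith))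
  have h10 : ∀ k, 0 ≤ freq k * ‖b k‖ + freq k ^ (r + 2) * ‖b k‖ ^ 2 := fun k =>
    add_nonneg (mul_nonneg (freq_nonneg k) (norm_nonneg _)) (energy_term_nonneg _ b k)
  have h2 := ha.summable_energy (r := r) (by linarith) (by linarith)
  have h20 := energy_term_nonneg r a
  have h3 := summable_freq_rpow hr2
  have h30 : ∀ k : Fin 2 → ℤ, 0 ≤ freq k ^ (-r) := fun k => Real.rpow_nonneg (freq_nonneg k) _
  have := ((hasSum_mul_fst_snd h1 h2 h10 h20).add (hasSum_mul_fst_add h1 h2 h10 h20)).add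
    ((hasSum_mul_snd_add h3 h2 h30 h20).add (hasSum_mul_snd_add h2 h3 h20 h30))
  have e : ∀ A B E : ℝ, 2 * (A + B) * E = A * E + A * E + (B * E + E * B) := fun A B E => by ring
  exact (e _ _ _).symm ▸ this

/-- The product of a linear weight with the amplitudes is bounded by the majorant. -/
lemma linWeight_le {r k l m β x y : ℝ} (hk : 0 ≤ k) (hl : 0 < l) (hm : 0 < m) (hβ : 0 ≤ β) :
    (k * l ^ (r / 2) * m ^ (r / 2) + k ^ (r / 2 + 1) * (l ^ (r / 2) + m ^ (r / 2)))
        * (β * x * y)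
      ≤ ((k * β + k ^ (r + 2) * β ^ 2) * (l ^ r * x ^ 2)
        + (k * β + k ^ (r + 2) * β ^ 2) * (m ^ r * y ^ 2)
        + (l ^ (-r) * (m ^ r * y ^ 2) + l ^ r * x ^ 2 * m ^ (-r))) / 2 := by
  have sq : ∀ {u : ℝ}, 0 ≤ u → ∀ s : ℝ, u ^ (2 * s) = (u ^ s) ^ 2 := fun hu s => by
    rw [← Real.rpow_natCast, ← Real.rpow_mul hu]; congr 1; push_cast; ring
  have el : l ^ r = (l ^ (r / 2)) ^ 2 := by rw [← sq hl.le]; ring_nf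
  have em : m ^ r = (m ^ (r / 2)) ^ 2 := by rw [← sq hm.le]; ring_nf
  have ek : k ^ (r + 2) = (k ^ (r / 2 + 1)) ^ 2 := by rw [← sq hk]; ring_nf
  rw [Real.rpow_neg hl.le, Real.rpow_neg hm.le, el, em, ek]
  have pl := Real.rpow_pos_of_pos hl (r / 2)
  have pm := Real.rpow_pos_of_pos hm (r / 2)
  generalize l ^ (r / 2) = L at *
  generalize m ^ (r / 2) = M at *
  generalize k ^ (r / 2 + 1) = K at *
  have q1 : k * L * M * (β * x * y) ≤ (k * β * (L ^ 2 * x ^ 2) + k * β * (M ^ 2 * y ^ 2)) / 2 := by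
    nlinarith [mul_nonneg (mul_nonneg hk hβ) (sq_nonneg (L * x - M * y))]
  -- Inserting M and M⁻¹ is the Fourier form of the embedding H^{r/2} ⊂ L^∞: the factor y, which
  -- carries no derivative, receives r/2 of them at the price of the summable weight M⁻².
  have q2 : K * L * (β * x * y) ≤ (K ^ 2 * β ^ 2 * (M ^ 2 * y ^ 2)
      + L ^ 2 * x ^ 2 * (M ^ 2)⁻¹) / 2 := by
    have h := sq_nonneg (K * β * (M * y) - L * x * M⁻¹)
    have e : (K * β * (M * y) - L * x * M⁻¹) ^ 2 = K ^ 2 * β ^ 2 * (M ^ 2 * y ^ 2)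
      + L ^ 2 * x ^ 2 * (M ^ 2)⁻¹ - 2 * (K * L * (β * x * y)) := by field_simp; ring
    linarith
  have q3 : K * M * (β * x * y) ≤ (K ^ 2 * β ^ 2 * (L ^ 2 * x ^ 2)
      + (L ^ 2)⁻¹ * (M ^ 2 * y ^ 2)) / 2 := by
    have h := sq_nonneg (K * β * (L * x) - M * y * L⁻¹)
    have e : (K * β * (L * x) - M * y * L⁻¹) ^ 2 = K ^ 2 * β ^ 2 * (L ^ 2 * x ^ 2)
      + (L ^ 2)⁻¹ * (M ^ 2 * y ^ 2) - 2 * (K * M * (β * x * y)) := by field_simp; ring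
    linarith
  nlinarith

/-- The mean value inequality gains the factor m - l ≤ k. If m ≤ 2l, the remaining powers are shared
between l and m. Otherwise l ≤ k and m ≤ 2k, and they go to k. -/
lemma rpow_sub_mul_le_of_le {r k l m : ℝ} (hr2 : 2 ≤ r) (hr : r ≤ 4) (hl : 0 < l)
    (hlm : l ≤ m) (hm : m ≤ k + l) :
    (m ^ r - l ^ r) * l ≤ 8 * (k * l ^ (r / 2) * m ^ (r / 2) + k ^ (r / 2 + 1) * m ^ (r / 2)) := by
  have hm0 : 0 < m := by linarith
  have hk : 0 ≤ k := by linarith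
  have pm := Real.rpow_pos_of_pos hm0 (r / 2)
  have pl := Real.rpow_pos_of_pos hl (r / 2)
  have pk := Real.rpow_nonneg hk (r / 2 + 1)
  have h1 := rpow_sub_rpow_le (s := r) (by linarith) hl.le hm0
  have e1 : m ^ (r - 1) = m ^ (r / 2) * m ^ (r / 2 - 1) := by
    rw [← Real.rpow_add hm0]; ring_nf
  have h2 : m ^ r - l ^ r ≤ 4 * m ^ (r - 1) * k := by
    refine h1.trans (mul_le_mul ?_ (by linarith) (by linarith) (by positivity))
    gcongr
  have dbl : ∀ {u : ℝ}, 0 ≤ u → (2 * u) ^ (r / 2 - 1) ≤ 2 * u ^ (r / 2 - 1) := fun {u} hu =>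
    calc (2 * u) ^ (r / 2 - 1) = 2 ^ (r / 2 - 1) * u ^ (r / 2 - 1) :=
          Real.mul_rpow (by norm_num) hu
      _ ≤ 2 ^ (1 : ℝ) * u ^ (r / 2 - 1) := by
          gcongr
          · norm_num
          · linarith
      _ = _ := by rw [Real.rpow_one]
  rcases le_total m (2 * l) with hc | hc
  · have h3 : m ^ (r / 2 - 1) ≤ 2 * l ^ (r / 2 - 1) :=
      (Real.rpow_le_rpow hm0.le hc (by linarith)).trans (dbl hl.le)
    have e2 : l ^ (r / 2) = l ^ (r / 2 - 1) * l := by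
      rw [Real.rpow_sub_one hl.ne']; field_simp
    calc _ ≤ 4 * (m ^ (r / 2) * (2 * l ^ (r / 2 - 1))) * k * l := by
          refine mul_le_mul_of_nonneg_right (h2.trans ?_) hl.le
          rw [e1]; gcongr
      _ = 8 * (k * l ^ (r / 2) * m ^ (r / 2)) := by rw [e2]; ring
      _ ≤ _ := by nlinarith [mul_nonneg pk pm.le]
  · have hk0 : 0 < k := by linarith
    have h3 : m ^ (r / 2 - 1) ≤ 2 * k ^ (r / 2 - 1) :=
      (Real.rpow_le_rpow hm0.le (by linarith) (by linarith)).trans (dbl hk)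
    have e2 : k ^ (r / 2 + 1) = k ^ (r / 2 - 1) * k * k := by
      rw [Real.rpow_add_one hk0.ne', Real.rpow_sub_one hk0.ne']; field_simp
    have pk' := Real.rpow_nonneg hk (r / 2 - 1)
    calc _ ≤ 4 * (m ^ (r / 2) * (2 * k ^ (r / 2 - 1))) * k * l := by
          refine mul_le_mul_of_nonneg_right (h2.trans ?_) hl.le
          rw [e1]; gcongr
      _ ≤ 4 * (m ^ (r / 2) * (2 * k ^ (r / 2 - 1))) * k * k := by gcongr; linarith
      _ = 8 * (k ^ (r / 2 + 1) * m ^ (r / 2)) := by rw [e2]; ring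
      _ ≤ _ := by nlinarith [mul_nonneg (mul_nonneg hk pl.le) pm.le]

lemma abs_rpow_sub_mul_le {r k l m Y : ℝ} (hr2 : 2 ≤ r) (hr : r ≤ 4) (hk : 0 ≤ k)
    (hl : 0 < l) (hm : 0 < m) (h1 : m ≤ k + l) (h2 : l ≤ k + m) (hYl : |Y| ≤ l)
    (hYm : |Y| ≤ m) :
    |(m ^ r - l ^ r) * Y| ≤ 8 * (k * l ^ (r / 2) * m ^ (r / 2)
      + k ^ (r / 2 + 1) * (l ^ (r / 2) + m ^ (r / 2))) := by
  have pm := Real.rpow_pos_of_pos hm (r / 2)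
  have pl := Real.rpow_pos_of_pos hl (r / 2)
  have pk := Real.rpow_nonneg hk (r / 2 + 1)
  rw [abs_mul]
  rcases le_total l m with h | h
  · have h0 : l ^ r ≤ m ^ r := Real.rpow_le_rpow hl.le h (by linarith)
    rw [abs_of_nonneg (by linarith)]
    have := rpow_sub_mul_le_of_le hr2 hr hl h h1
    nlinarith [mul_le_mul_of_nonneg_left hYl (by linarith : 0 ≤ m ^ r - l ^ r),
      mul_nonneg pk pl.le]
  · have h0 : m ^ r ≤ l ^ r := Real.rpow_le_rpow hm.le h (by linarith)
    rw [abs_of_nonpos (by linarith)]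
    have := rpow_sub_mul_le_of_le hr2 hr hm h h2
    nlinarith [mul_le_mul_of_nonneg_left hYm (by linarith : 0 ≤ l ^ r - m ^ r),
      mul_nonneg pk pm.le]

lemma cross_eq_zero_or (k l : Fin 2 → ℤ) : cross k l = 0 ∨ (0 < freq l ∧ 0 < freq (k + l)) := by
  by_contra! h
  obtain ⟨h0, h1⟩ := h
  have hc : 0 < |cross k l| := abs_pos.2 h0
  have hl : 0 < freq l := by
    rcases (freq_nonneg l).eq_or_lt with e | e
    · have := abs_cross_le k l; rw [← e, mul_zero] at this; linarith
    · exact e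
  have := h1 hl
  have h2 := abs_cross_le_left k l
  have h3 := freq_nonneg (k + l)
  have h4 : freq (k + l) = 0 := le_antisymm this h3
  rw [h4, mul_zero] at h2
  linarith

lemma abs_cross_div_le' (k l : Fin 2 → ℤ) : |cross k l / freq k| ≤ freq (k + l) := by
  have := abs_cross_div_le k (-(k + l))
  rwa [cross_neg_add, neg_div, abs_neg, freq_neg] at this

/-- The estimate of the term where the coefficient is the velocity. -/
lemma norm_tri_velocity_le {r : ℝ} (hr2 : 2 < r) (hr : r < 4) {b a : (Fin 2 → ℤ) → ℂ}
    (hb : SeqH3 b) (ha : SeqH3 a) (hre : IsReal a) :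
    ‖∑' z, triTerm r b a a z‖ ≤ 4 * linConst r b * energy r a := by
  have hT := (summable_triTerm (r := r) (by linarith) hr hb ha ha).hasSum
  set S := ∑' z, triTerm r b a a z
  -- Exchanging l with -(k+l) reverses the cross product, as the velocity is divergence free. Adding
  -- the two copies leaves the commutator |k+l|^r - |l|^r, which removes the loss of a derivative on
  -- a.
  have hflip : HasSum (fun z : (Fin 2 → ℤ) × (Fin 2 → ℤ) =>
      triTerm r b a a (z.1, -(z.1 + z.2))) S :=
    (rotEquiv.symm.trans swapEquiv).hasSum_iff.2 hT
  have h2 := hT.add hflip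
  have hM := (linMajorant_hasSum hr2 hr hb ha).mul_left 4
  have hle := tsum_of_norm_bounded hM (f := fun z : (Fin 2 → ℤ) × (Fin 2 → ℤ) =>
    triTerm r b a a z + triTerm r b a a (z.1, -(z.1 + z.2))) ?_
  · rw [h2.tsum_eq, ← two_mul, norm_mul] at hle
    norm_num at hle
    linarith
  · rintro ⟨k, l⟩
    have s4 : k + -(k + l) = -l := by abel
    have hl : conj (a (-l)) = a l := by rw [hre, Complex.conj_conj]
    have e : triTerm r b a a (k, l) + triTerm r b a a (k, -(k + l))
        = (((freq (k + l) ^ r - freq l ^ r) * (cross k l / freq k) : ℝ) : ℂ)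
          * (b k * a l * conj (a (k + l))) := by
      simp only [triTerm, cross_neg_add, s4, hl, hre (k + l), freq_neg]
      push_cast
      ring
    dsimp only
    rw [e, norm_mul, norm_mul, norm_mul, RCLike.norm_conj, Complex.norm_real, Real.norm_eq_abs]
    rcases cross_eq_zero_or k l with h0 | ⟨hl0, hm0⟩
    · have := linMajorant_nonneg r b a (k, l)
      rw [h0, zero_div, mul_zero, abs_zero, zero_mul]
      linarith
    · have hW := abs_rpow_sub_mul_le (r := r) (k := freq k) (l := freq l) (m := freq (k + l))
        (Y := cross k l / freq k) hr2.le hr.le (freq_nonneg k) hl0 hm0 (freq_add_le k l)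
        (by have := freq_triangle l k; rwa [add_comm l k] at this)
        (abs_cross_div_le k l) (abs_cross_div_le' k l)
      have hV := linWeight_le (r := r) (β := ‖b k‖) (x := ‖a l‖) (y := ‖a (k + l)‖)
        (freq_nonneg k) hl0 hm0 (norm_nonneg _)
      rw [linMajorant]
      dsimp only
      refine (mul_le_mul_of_nonneg_right hW (by positivity)).trans ?_
      linarith

/-- The estimate of the term where the coefficient is transported. -/
lemma norm_tri_transported_le {r : ℝ} (hr2 : 2 < r) (hr : r < 4) {b a : (Fin 2 → ℤ) → ℂ}
    (hb : SeqH3 b) (ha : SeqH3 a) :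
    ‖∑' z, triTerm r a b a z‖ ≤ 4 * linConst r b * energy r a := by
  have hM := (swapEquiv.hasSum_iff.2 (linMajorant_hasSum hr2 hr hb ha)).mul_left 2
  refine (tsum_of_norm_bounded hM ?_).trans (by linarith)
  rintro ⟨l, k⟩
  simp only [Function.comp, swapEquiv, Equiv.prodComm_apply, Prod.swap_prod_mk, triTerm]
  have hk := freq_nonneg k
  rw [norm_mul, norm_mul, norm_mul, RCLike.norm_conj, Complex.norm_real, Real.norm_eq_abs,
    add_comm l k]
  have hc := cross_eq_zero_or k l
  rw [cross_comm l k, neg_eq_zero] at hc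
  rcases hc with h0 | ⟨hl0, hm0⟩
  · have := linMajorant_nonneg r b a (k, l)
    rw [h0, zero_div, mul_zero, abs_zero, zero_mul]
    linarith
  · have hV := linWeight_le (r := r) (β := ‖b k‖) (x := ‖a l‖) (y := ‖a (k + l)‖)
      hk hl0 hm0 (norm_nonneg _)
    have pm := Real.rpow_pos_of_pos hm0 (r / 2)
    have pl := Real.rpow_pos_of_pos hl0 (r / 2)
    have pk := Real.rpow_nonneg hk (r / 2)
    have hY := abs_cross_div_le l k
    have hmm : freq (k + l) ^ r = freq (k + l) ^ (r / 2) * freq (k + l) ^ (r / 2) := by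
      rw [← Real.rpow_add hm0]; ring_nf
    -- Only half of the power |k+l|^r is distributed onto k and l; the other half stays on the test
    -- factor. No cancellation is needed, because the kernel is at most |k|.
    have hm2 : freq (k + l) ^ (r / 2) ≤ 4 * (freq k ^ (r / 2) + freq l ^ (r / 2)) := by
      have two : ∀ {u : ℝ}, 0 ≤ u → freq (k + l) ≤ 2 * u → freq (k + l) ^ (r / 2) ≤
          4 * u ^ (r / 2) := fun {u} hu h =>
        calc freq (k + l) ^ (r / 2) ≤ (2 * u) ^ (r / 2) :=
              Real.rpow_le_rpow hm0.le h (by linarith)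
          _ = 2 ^ (r / 2) * u ^ (r / 2) := Real.mul_rpow (by norm_num) hu
          _ ≤ 2 ^ (2 : ℝ) * u ^ (r / 2) := by
              gcongr
              · norm_num
              · linarith
          _ = _ := by norm_num
      have ht := freq_add_le k l
      rcases le_total (freq k) (freq l) with h | h
      · linarith [two hl0.le (by linarith)]
      · linarith [two hk (by linarith)]
    have e1 : freq k ^ (r / 2 + 1) = freq k ^ (r / 2) * freq k := by
      rw [Real.rpow_add_of_nonneg hk (by linarith) zero_le_one, Real.rpow_one]
    have hW : |freq (k + l) ^ r * (cross l k / freq l)| ≤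
        4 * (freq k * freq l ^ (r / 2) * freq (k + l) ^ (r / 2)
          + freq k ^ (r / 2 + 1) * (freq l ^ (r / 2) + freq (k + l) ^ (r / 2))) := by
      rw [abs_mul, abs_of_nonneg (Real.rpow_nonneg hm0.le _), hmm, e1]
      calc _ ≤ freq (k + l) ^ (r / 2) * (4 * (freq k ^ (r / 2) + freq l ^ (r / 2))) * freq k := by
            gcongr
        _ ≤ _ := by nlinarith [mul_nonneg (mul_nonneg pk hk) pl.le]
    rw [linMajorant]
    dsimp only
    calc _ ≤ _ := mul_le_mul_of_nonneg_right hW (by positivity)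
      _ = 4 * ((freq k * freq l ^ (r / 2) * freq (k + l) ^ (r / 2)
          + freq k ^ (r / 2 + 1) * (freq l ^ (r / 2) + freq (k + l) ^ (r / 2)))
          * (‖b k‖ * ‖a l‖ * ‖a (k + l)‖)) := by ring
      _ ≤ _ := by linarith

/-! ### Interpolation and the differential inequality -/

lemma isReal_coeff (g : T2 → ℝ) : IsReal (coeff g) := coeff_neg g

/-- Here r exceeds 2(2-γ) by 2γ/3. With y = |ξ|^γ the claim is, frequency by frequency, x y^(2/3) ≤
x^(5/3) + y^(5/3), which is clear separately for y ≤ x and for x ≤ y. -/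
lemma energy_interpolation {γ r x : ℝ} (hγ0 : 0 < γ) (hγ1 : γ < 1) (hr : r = 4 - 4 * γ / 3)
    (hx : 0 < x) {a : (Fin 2 → ℤ) → ℂ} (ha : SeqH3 a) :
    x * energy r a ≤ x ^ (5 / 3 : ℝ) * energy (2 * (2 - γ)) a + energy (r + γ) a := by
  have h1 := ha.summable_energy (r := r) (by linarith) (by linarith)
  have h2 := ha.summable_energy (r := 2 * (2 - γ)) (by linarith) (by linarith)
  have h3 := ha.summable_energy (r := r + γ) (by linarith) (by linarith)
  unfold energy
  rw [← tsum_mul_left, ← tsum_mul_left, ← (h2.mul_left _).tsum_add h3]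
  refine (h1.mul_left x).tsum_le_tsum (fun k => ?_) ((h2.mul_left _).add h3)
  have hf := freq_nonneg k
  have e1 : freq k ^ r = freq k ^ (2 * (2 - γ)) * (freq k ^ γ) ^ (2 / 3 : ℝ) := by
    rw [← Real.rpow_mul hf, ← Real.rpow_add_of_nonneg hf (by linarith) (by positivity), hr]
    ring_nf
  have e2 : freq k ^ (r + γ) = freq k ^ r * freq k ^ γ :=
    Real.rpow_add_of_nonneg hf (by linarith) hγ0.le
  have e3 : x ^ (5 / 3 : ℝ) = x * x ^ (2 / 3 : ℝ) := by
    rw [show (5 / 3 : ℝ) = 1 + 2 / 3 by norm_num, Real.rpow_add hx, Real.rpow_one]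
  have p1 := Real.rpow_nonneg hf r
  have p2 := Real.rpow_nonneg hf γ
  have p3 := Real.rpow_nonneg hf (2 * (2 - γ))
  have key : x * freq k ^ r ≤ x ^ (5 / 3 : ℝ) * freq k ^ (2 * (2 - γ)) + freq k ^ (r + γ) := by
    rcases le_total (freq k ^ γ) x with h | h
    · have h4 : (freq k ^ γ) ^ (2 / 3 : ℝ) ≤ x ^ (2 / 3 : ℝ) :=
        Real.rpow_le_rpow p2 h (by norm_num)
      have h5 : x * freq k ^ r ≤ x ^ (5 / 3 : ℝ) * freq k ^ (2 * (2 - γ)) :=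
        calc x * freq k ^ r = x * freq k ^ (2 * (2 - γ)) * (freq k ^ γ) ^ (2 / 3 : ℝ) := by
              rw [e1]; ring
          _ ≤ x * freq k ^ (2 * (2 - γ)) * x ^ (2 / 3 : ℝ) := by gcongr
          _ = _ := by rw [e3]; ring
      have := Real.rpow_nonneg hf (r + γ)
      linarith
    · have h5 : x * freq k ^ r ≤ freq k ^ (r + γ) := by
        rw [e2, mul_comm]; gcongr
      have : 0 ≤ x ^ (5 / 3 : ℝ) * freq k ^ (2 * (2 - γ)) := by positivity
      linarith
  linarith [mul_le_mul_of_nonneg_right key (sq_nonneg ‖a k‖)]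

lemma energy_critical_le {γ : ℝ} (hγ1 : γ < 1) {g : T2 → ℝ} (hg : MemHs (2 - γ) g) :
    energy (2 * (2 - γ)) (coeff g) ≤ hNorm (2 - γ) g ^ 2 := by
  have hle : ∀ k, freq k ^ (2 * (2 - γ)) * ‖coeff g k‖ ^ 2
      ≤ (1 + freq k ^ 2) ^ (2 - γ) * ‖coeff g k‖ ^ 2 := fun k => by
    rw [Real.rpow_mul (freq_nonneg k), Real.rpow_two]
    gcongr
    · linarith
    · linarith
  rw [hNorm, Real.sq_sqrt (tsum_nonneg fun k => by positivity)]
  exact (hg.2.of_nonneg_of_le (energy_term_nonneg _ _) hle).tsum_le_tsum hle hg.2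

/-- The time derivative of the energy satisfies a dissipative estimate. -/
lemma energy_deriv_le {γ r : ℝ} (hγ0 : 0 < γ) (hγ1 : γ < 1) (hr2 : 2 < r) (hr : r < 4)
    {a b a' : (Fin 2 → ℤ) → ℂ} (ha : SeqH3 a) (hb : SeqH3 b) (hre : IsReal a)
    (ha' : ∀ n, a' n = -advect b a n - advect a b n - (freq n ^ γ : ℝ) * a n - advect a a n)
    (hsmall : Real.sqrt (energy (2 * (2 - γ)) a) ≤ γ / 80) :
    ∑' k, freq k ^ r * (2 * (conj (a k) * a' k).re)
      ≤ -energy (r + γ) a + 16 * linConst r b * energy r a := by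
  have hr0 : 0 ≤ r := by linarith
  have h1 := hasSum_advect_pairing hr0 hr hb ha ha
  have h2 := hasSum_advect_pairing hr0 hr ha hb ha
  have h3 := hasSum_advect_pairing hr0 hr ha ha ha
  have b1 := norm_tri_velocity_le hr2 hr hb ha hre
  have b2 := norm_tri_transported_le hr2 hr hb ha
  have b3 := norm_tri_le hγ0 hγ1 (by linarith) hr ha hre
  set S1 := ∑' z, triTerm r b a a z
  set S2 := ∑' z, triTerm r a b a z
  set S3 := ∑' z, triTerm r a a a z
  have hE := (ha.summable_energy (r := r + γ) (by linarith) (by linarith)).hasSum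
  have h123 := (Complex.hasSum_re ((h1.add h2).add h3)).mul_left (-2)
  have hall := h123.add (hE.mul_left (-2))
  have hD := energy_nonneg (r + γ) a
  have heq : HasSum (fun k => freq k ^ r * (2 * (conj (a k) * a' k).re))
      (-2 * (S1 + S2 + S3).re + -2 * energy (r + γ) a) := by
    refine hall.congr_fun fun k => ?_
    rw [ha', Real.rpow_add_of_nonneg (freq_nonneg k) hr0 hγ0.le, ← Complex.normSq_eq_norm_sq,
      Complex.normSq_apply]
    simp only [Complex.add_re, Complex.sub_re, Complex.sub_im, Complex.mul_re, Complex.mul_im,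
      Complex.neg_re, Complex.neg_im, Complex.conj_re, Complex.conj_im, Complex.ofReal_re,
      Complex.ofReal_im]
    ring
  rw [heq.tsum_eq]
  have hn : |(S1 + S2 + S3).re| ≤ ‖S1‖ + ‖S2‖ + ‖S3‖ :=
    (Complex.abs_re_le_norm _).trans (norm_add₃_le)
  -- Smallness is used here: after the factor 2 from differentiating the square, the cubic term
  -- takes at most one of the two copies of the dissipation.
  have hs : 40 / γ * Real.sqrt (energy (2 * (2 - γ)) a) * energy (r + γ) a
      ≤ 1 / 2 * energy (r + γ) a := by
    refine mul_le_mul_of_nonneg_right ?_ hD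
    calc _ ≤ 40 / γ * (γ / 80) := by gcongr
      _ = 1 / 2 := by field_simp; norm_num
  have := neg_le_of_abs_le hn
  linarith

/-! ### Smoothing from the differential inequality -/

/-- A differential inequality of parabolic smoothing type. -/
lemma smoothing_of_deriv_le {E : ℝ → ℝ} {A K : ℝ} (hK : 0 ≤ K) (hA : 0 ≤ A)
    (hE : ∀ t, 0 < t → ∃ E', HasDerivAt E E' t ∧
      ∀ x : ℝ, 0 < x → E' ≤ -(x - K) * E t + A * x ^ (5 / 3 : ℝ)) {t : ℝ} (ht : 0 < t) :
    E t ≤ 3 * (A * (K + 1) ^ (5 / 3 : ℝ)) * (min (t / 2) 1) ^ (-(2 / 3) : ℝ) := by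
  -- The argument runs on [t - T, t]. T ≤ t/2 keeps this interval inside positive times, where E is
  -- differentiable, and T ≤ 1 is used to bound K + 1/τ by (K+1)/τ.
  set T := min (t / 2) 1 with hT
  set M := A * (K + 1) ^ (5 / 3 : ℝ)
  have hT0 : 0 < T := lt_min (by linarith) one_pos
  have hTt : T ≤ t / 2 := min_le_left _ _
  have hT1 : T ≤ 1 := min_le_right _ _
  choose! E' hd hE' using hE
  have hs : ∀ τ, 0 ≤ τ → 0 < t - T + τ := fun τ h => by linarith
  have hder : ∀ τ, 0 < τ → HasDerivAt (fun τ => τ * E (t - T + τ) - 3 * M * τ ^ (1 / 3 : ℝ))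
      (1 * E (t - T + τ) + τ * E' (t - T + τ) - 3 * M * (1 / 3 * τ ^ (1 / 3 - 1 : ℝ))) τ := by
    intro τ hτ
    have h1 : HasDerivAt (fun τ => E (t - T + τ)) (E' (t - T + τ)) τ :=
      (hd _ (hs τ hτ.le)).comp_const_add (t - T) τ
    exact ((hasDerivAt_id τ).mul h1).sub
      ((Real.hasDerivAt_rpow_const (Or.inl hτ.ne')).const_mul (3 * M))
  -- The weight τ vanishes at the left end, so no starting value of E enters, and 3Mτ^(1/3) is the
  -- primitive of the forcing Mτ^(-2/3).
  have hanti : AntitoneOn (fun τ => τ * E (t - T + τ) - 3 * M * τ ^ (1 / 3 : ℝ))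
      (Set.Icc 0 T) := by
    refine antitoneOn_of_deriv_nonpos (convex_Icc 0 T) ?_ ?_ ?_
    · intro τ hτ
      have h1 : ContinuousAt (fun τ => E (t - T + τ)) τ :=
        ((hd _ (hs τ hτ.1)).comp_const_add (t - T) τ).continuousAt
      have h2 : ContinuousAt (fun τ : ℝ => τ ^ (1 / 3 : ℝ)) τ :=
        Real.continuousAt_rpow_const _ _ (Or.inr (by norm_num))
      exact ((continuousAt_id.mul h1).sub (continuousAt_const.mul h2)).continuousWithinAt
    · intro τ hτ
      rw [interior_Icc] at hτ
      exact (hder τ hτ.1).differentiableAt.differentiableWithinAt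
    · intro τ hτ
      rw [interior_Icc] at hτ
      rw [(hder τ hτ.1).deriv]
      have hτ0 := hτ.1
      -- With this x the damping rate x - K is 1/τ, so the damping cancels the term E produced by
      -- differentiating τE.
      have hx := hE' _ (hs τ hτ0.le) (K + 1 / τ) (by positivity)
      have hb : (K + 1 / τ) ^ (5 / 3 : ℝ) ≤ (K + 1) ^ (5 / 3 : ℝ) * (τ⁻¹) ^ (5 / 3 : ℝ) := by
        rw [← Real.mul_rpow (by linarith) (by positivity)]
        refine Real.rpow_le_rpow (by positivity) ?_ (by norm_num)
        have : 1 ≤ τ⁻¹ := (one_le_inv₀ hτ0).2 (by linarith [hτ.2])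
        rw [one_div]; nlinarith
      have e : τ * (τ⁻¹) ^ (5 / 3 : ℝ) = τ ^ (1 / 3 - 1 : ℝ) := by
        rw [Real.inv_rpow hτ0.le, ← Real.rpow_neg hτ0.le]
        nth_rewrite 1 [← Real.rpow_one τ]
        rw [← Real.rpow_add hτ0]; norm_num
      have h3 : τ * E' (t - T + τ) ≤ -E (t - T + τ) + M * τ ^ (1 / 3 - 1 : ℝ) :=
        calc τ * E' (t - T + τ)
            ≤ τ * (-(K + 1 / τ - K) * E (t - T + τ)
              + A * ((K + 1) ^ (5 / 3 : ℝ) * (τ⁻¹) ^ (5 / 3 : ℝ))) := by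
              refine mul_le_mul_of_nonneg_left (hx.trans ?_) hτ0.le
              gcongr
          _ = -E (t - T + τ) + M * (τ * (τ⁻¹) ^ (5 / 3 : ℝ)) := by
              simp only [M]; field_simp; ring
          _ = _ := by rw [e]
      linarith
  have h := hanti (Set.left_mem_Icc.2 hT0.le) (Set.right_mem_Icc.2 hT0.le) hT0.le
  simp only [zero_mul, sub_add_cancel] at h
  rw [Real.zero_rpow (by norm_num), mul_zero, sub_zero, sub_nonpos] at h
  have e : T ^ (-(2 / 3) : ℝ) = T ^ (1 / 3 : ℝ) / T := by
    rw [← Real.rpow_sub_one hT0.ne']; norm_num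
  rw [e, ← mul_div_assoc, le_div_iff₀ hT0]
  linarith

/-! ### Regular solutions: energy derivative and return to Sobolev norms -/

lemma sqH3_le_of_sub {a c : (Fin 2 → ℤ) → ℂ} (h : SeqH3 fun k => a k - c k) (hc : SeqH3 c)
    (ha : SeqH3 a) : sqH3 a ≤ 2 * sqH3 (fun k => a k - c k) + 2 * sqH3 c := by
  unfold sqH3
  rw [← tsum_mul_left, ← tsum_mul_left, ← (h.mul_left 2).tsum_add (hc.mul_left 2)]
  refine ha.tsum_le_tsum (fun k => ?_) ((h.mul_left 2).add (hc.mul_left 2))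
  have h1 : ‖a k‖ ≤ ‖a k - c k‖ + ‖c k‖ := by simpa using norm_add_le (a k - c k) (c k)
  have h2 : ‖a k‖ ^ 2 ≤ 2 * ‖a k - c k‖ ^ 2 + 2 * ‖c k‖ ^ 2 := by
    nlinarith [norm_nonneg (a k), sq_nonneg (‖a k - c k‖ - ‖c k‖)]
  have hp := pow_pos (wt_pos k) 6
  nlinarith

lemma MemHs.sub {g h : T2 → ℝ} (hg : MemHs 3 g) (hh : MemHs 3 h) :
    MemHs 3 fun x => g x - h x := by
  refine ⟨hg.1.sub hh.1, ?_⟩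
  refine ((hg.2.mul_left 2).add (hh.2.mul_left 2)).of_nonneg_of_le
    (fun k => by positivity) fun k => ?_
  rw [coeff_sub hg.integrable hh.integrable]
  have h1 := norm_sub_le (coeff g k) (coeff h k)
  have h2 : ‖coeff g k - coeff h k‖ ^ 2 ≤ 2 * ‖coeff g k‖ ^ 2 + 2 * ‖coeff h k‖ ^ 2 := by
    nlinarith [norm_nonneg (coeff g k - coeff h k), sq_nonneg (‖coeff g k‖ - ‖coeff h k‖)]
  have hp : 0 ≤ (1 + freq k ^ 2) ^ (3 : ℝ) := by positivity
  nlinarith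

lemma ContinuousInHs.eventually_bounded {θ : ℝ → T2 → ℝ}
    (h : ContinuousInHs 3 (Set.Ioi 0) θ) {t : ℝ} (ht : 0 < t) :
    ∃ B, ∀ᶠ τ in 𝓝 t, SeqH3 (coeff (θ τ)) ∧ sqH3 (coeff (θ τ)) ≤ B := by
  have ht' := h.1 t ht
  have hlim := h.2 t ht
  rw [IsOpen.nhdsWithin_eq isOpen_Ioi ht] at hlim
  refine ⟨2 * 8 + 2 * sqH3 (coeff (θ t)), ?_⟩
  filter_upwards [hlim.eventually_lt_const one_pos, Ioi_mem_nhds ht] with τ h1 h2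
  have hτ := h.1 τ h2
  have hs := hτ.sub ht'
  have e : coeff (fun x => θ τ x - θ t x) = fun k => coeff (θ τ) k - coeff (θ t) k := by
    ext k; exact coeff_sub hτ.integrable ht'.integrable k
  have h3 := hs.sqH3_le
  have h4 := hs.seqH3
  have h0 : 0 ≤ hNorm 3 fun x => θ τ x - θ t x := Real.sqrt_nonneg _
  rw [e] at h3 h4
  refine ⟨hτ.seqH3, (sqH3_le_of_sub h4 ht'.seqH3 hτ.seqH3).trans ?_⟩
  nlinarith

lemma IsRegularSolution.energy_hasDerivAt {γ r : ℝ} (hγ0 : 0 < γ) (hγ1 : γ < 1) (hr0 : 0 ≤ r)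
    (hr : r < 4) {Θ₀ : T2 → ℝ} (hΘ : MemHs 3 Θ₀) {θ : ℝ → T2 → ℝ}
    (hθ : IsRegularSolution γ Θ₀ θ) {t : ℝ} (ht : 0 < t) :
    HasDerivAt (fun τ => energy r (coeff (θ τ)))
      (∑' k, freq k ^ r * (2 * (conj (coeff (θ t) k) *
        coeff (fun x => linearized γ Θ₀ (θ t) x + nonlinearity (θ t) x) k).re)) t := by
  obtain ⟨B, hB⟩ := hθ.continuous_pos.eventually_bounded ht
  set b := coeff Θ₀
  refine hasDerivAt_energy hr0 hr (a := fun τ => coeff (θ τ))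
    (a' := fun τ k => coeff (fun x => linearized γ Θ₀ (θ τ) x + nonlinearity (θ τ) x) k)
    (B := B) (M := 2 * (sqH3 b + B) + (1 + B) + 2 * B) hB ?_ ?_
  · filter_upwards [Ioi_mem_nhds ht] with τ hτ k using hθ.equation τ hτ k
  · filter_upwards [Ioi_mem_nhds ht, hB] with τ hτ hBτ k
    have hmem := hθ.continuous_pos.1 τ hτ
    rw [coeff_rhs hγ0 hγ1 hΘ hmem]
    set a := coeff (θ τ)
    have hb : SeqH3 b := hΘ.seqH3
    have ha : SeqH3 a := hBτ.1
    have hp := one_le_wt k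
    have n1 := norm_advect_le hb ha k
    have n2 := norm_advect_le ha hb k
    have n3 := norm_advect_le ha ha k
    have n4 : wt k ^ 2 * ‖((freq k ^ γ : ℝ) : ℂ) * a k‖ ≤ 1 + sqH3 a := by
      rw [norm_mul, Complex.norm_real, Real.norm_of_nonneg (Real.rpow_nonneg (freq_nonneg k) _)]
      have h6 : wt k ^ 6 * ‖a k‖ ^ 2 ≤ sqH3 a :=
        ha.le_tsum k fun j _ => mul_nonneg (pow_nonneg (wt_pos j).le _) (sq_nonneg _)
      calc _ ≤ wt k ^ 2 * (wt k * ‖a k‖) := by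
            gcongr; exact freq_rpow_le_wt hγ0 hγ1 k
        _ = wt k ^ 3 * ‖a k‖ := by ring
        _ ≤ 1 + wt k ^ 6 * ‖a k‖ ^ 2 := by nlinarith [sq_nonneg (wt k ^ 3 * ‖a k‖ - 1)]
        _ ≤ _ := by linarith
    have htri : ‖-advect b a k - advect a b k - ((freq k ^ γ : ℝ) : ℂ) * a k - advect a a k‖
        ≤ ‖advect b a k‖ + ‖advect a b k‖ + ‖((freq k ^ γ : ℝ) : ℂ) * a k‖ + ‖advect a a k‖ := by
      refine (norm_sub_le _ _).trans (add_le_add_left ((norm_sub_le _ _).trans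
        (add_le_add_left ((norm_sub_le _ _).trans_eq ?_) _)) _)
      rw [norm_neg]
    have := mul_le_mul_of_nonneg_left htri (sq_nonneg (wt k))
    linarith [hBτ.2]

/-- The homogeneous energy misses the zero mode, which the H^{2-γ} norm controls. At other
frequencies 1 + |ξ|² ≤ 2|ξ|², and 2 is raised to a power below 2. -/
lemma hNorm_sq_le {γ : ℝ} (hγ0 : 0 < γ) (hγ1 : γ < 1) {g : T2 → ℝ} (hg : MemHs 3 g)
    (hg' : MemHs (2 - γ) g) :
    MemHs (2 - 2 * γ / 3) g ∧ hNorm (2 - 2 * γ / 3) g ^ 2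
      ≤ 4 * energy (4 - 4 * γ / 3) (coeff g) + hNorm (2 - γ) g ^ 2 := by
  have hE := hg.seqH3.summable_energy (r := 4 - 4 * γ / 3) (by linarith) (by linarith)
  have hle : ∀ k, (1 + freq k ^ 2) ^ (2 - 2 * γ / 3) * ‖coeff g k‖ ^ 2
      ≤ 4 * (freq k ^ (4 - 4 * γ / 3) * ‖coeff g k‖ ^ 2)
        + (1 + freq k ^ 2) ^ (2 - γ) * ‖coeff g k‖ ^ 2 := by
    intro k
    rcases eq_or_ne k 0 with rfl | hk
    · have := energy_term_nonneg (4 - 4 * γ / 3) (coeff g) 0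
      simp only [freq_zero] at this ⊢
      simp only [ne_eq, OfNat.ofNat_ne_zero, not_false_eq_true, zero_pow, add_zero, Real.one_rpow]
      linarith
    · have h1 := one_le_freq hk
      have h2 : (1 + freq k ^ 2) ^ (2 - 2 * γ / 3) ≤ 4 * freq k ^ (4 - 4 * γ / 3) :=
        calc (1 + freq k ^ 2) ^ (2 - 2 * γ / 3) ≤ (2 * freq k ^ 2) ^ (2 - 2 * γ / 3) :=
              Real.rpow_le_rpow (by positivity) (by nlinarith) (by linarith)
          _ = 2 ^ (2 - 2 * γ / 3) * (freq k ^ 2) ^ (2 - 2 * γ / 3) :=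
              Real.mul_rpow (by norm_num) (by positivity)
          _ ≤ 2 ^ (2 : ℝ) * (freq k ^ 2) ^ (2 - 2 * γ / 3) := by
              gcongr
              · norm_num
              · linarith
          _ = 4 * freq k ^ (4 - 4 * γ / 3) := by
              rw [← Real.rpow_natCast, ← Real.rpow_mul (by linarith)]
              norm_num
              ring_nf
      have h3 : 0 ≤ (1 + freq k ^ 2) ^ (2 - γ) * ‖coeff g k‖ ^ 2 := by positivity
      nlinarith [mul_le_mul_of_nonneg_right h2 (sq_nonneg ‖coeff g k‖)]
  have hsum := (hE.mul_left 4).add hg'.2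
  have hS := hsum.of_nonneg_of_le (fun k => by positivity) hle
  refine ⟨⟨hg.1, hS⟩, ?_⟩
  rw [hNorm, hNorm, Real.sq_sqrt (tsum_nonneg fun k => by positivity),
    Real.sq_sqrt (tsum_nonneg fun k => by positivity), energy, ← tsum_mul_left,
    ← (hE.mul_left 4).tsum_add hg'.2]
  exact hS.tsum_le_tsum hle hsum

end SQG

end

/-! ### Conclusion -/

theorem proposition2p5 (γ : ℝ) (hγ0 : 0 < γ) (hγ1 : γ < 1) :
    ∃ C₀ : ℝ, 0 < C₀ ∧
      ∀ f Θ₀ : SQG.T2 → ℝ, SQG.MemHs 3 f → ∫ x, f x = 0 →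
        SQG.MemHs 3 Θ₀ → SQG.IsSteady γ f Θ₀ →
        ∃ C : ℝ, 0 < C ∧
          ∀ θ : ℝ → SQG.T2 → ℝ, SQG.IsRegularSolution γ Θ₀ θ →
            (∀ t : ℝ, 0 ≤ t → SQG.hNorm (2 - γ) (θ t) ≤ C₀) →
            ∀ t : ℝ, 0 < t →
              SQG.MemHs (2 - 2 * γ / 3) (θ t) ∧
                SQG.hNorm (2 - 2 * γ / 3) (θ t) ≤ C * (1 + t ^ (-(1 / 3) : ℝ)) := by
  -- γ/80 is the size at which the cubic constant 40/γ becomes 1/2.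
  refine ⟨γ / 80, by positivity, fun f Θ₀ _ _ hΘ _ => ?_⟩
  set r : ℝ := 4 - 4 * γ / 3 with hr
  set K : ℝ := 16 * SQG.linConst r (SQG.coeff Θ₀) with hK
  have hK0 : 0 ≤ K := mul_nonneg (by norm_num) (SQG.linConst_nonneg _ _)
  set A : ℝ := (γ / 80) ^ 2 with hA
  set M : ℝ := A * (K + 1) ^ (5 / 3 : ℝ) with hM
  have hM0 : 0 ≤ M := by positivity
  -- With y = t^(-1/3), the squared norm is at most 4·3M(2y² + 1) + A = 24My² + 12M + A, hence at
  -- most (36M + A)(1 + y)².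
  refine ⟨Real.sqrt (36 * M + A), Real.sqrt_pos.2 (by positivity), fun θ hθ hsmall t ht => ?_⟩
  have hH3 : ∀ s, 0 < s → SQG.MemHs 3 (θ s) := hθ.continuous_pos.1
  have hcrit : ∀ s, 0 < s → SQG.MemHs (2 - γ) (θ s) := fun s hs => hθ.continuous_zero.1 s hs.le
  have hN : ∀ s, 0 < s → SQG.hNorm (2 - γ) (θ s) ^ 2 ≤ A := fun s hs =>
    pow_le_pow_left₀ (Real.sqrt_nonneg _) (hsmall s hs.le) 2
  have hE : SQG.energy r (SQG.coeff (θ t)) ≤ 3 * M * (min (t / 2) 1) ^ (-(2 / 3) : ℝ) := by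
    refine SQG.smoothing_of_deriv_le (E := fun s => SQG.energy r (SQG.coeff (θ s))) hK0
      (by positivity) (fun s hs => ⟨_, hθ.energy_hasDerivAt hγ0 hγ1 (r := r) (by linarith)
        (by linarith) hΘ hs, fun x hx => ?_⟩) ht
    have h0 := (SQG.energy_critical_le hγ1 (hcrit s hs)).trans (hN s hs)
    have h1 := SQG.energy_deriv_le (r := r) hγ0 hγ1 (by linarith) (by linarith) (hH3 s hs).seqH3
      hΘ.seqH3 (SQG.isReal_coeff (θ s)) (SQG.coeff_rhs hγ0 hγ1 hΘ (hH3 s hs))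
      ((Real.sqrt_le_sqrt h0).trans_eq (Real.sqrt_sq (by positivity)))
    have h2 := SQG.energy_interpolation hγ0 hγ1 hr hx (hH3 s hs).seqH3
    have h3 := mul_le_mul_of_nonneg_left h0 (Real.rpow_nonneg hx.le (5 / 3))
    refine h1.trans ?_
    rw [← hK]
    linarith
  have hmin : (min (t / 2) 1) ^ (-(2 / 3) : ℝ) ≤ 2 * t ^ (-(2 / 3) : ℝ) + 1 := by
    have hp := Real.rpow_pos_of_pos ht (-(2 / 3))
    rcases le_total (t / 2) 1 with h | h
    · rw [min_eq_left h, Real.div_rpow ht.le (by norm_num), Real.rpow_neg (x := 2) (by norm_num),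
        div_inv_eq_mul]
      have : (2 : ℝ) ^ (2 / 3 : ℝ) ≤ 2 := by
        calc (2 : ℝ) ^ (2 / 3 : ℝ) ≤ 2 ^ (1 : ℝ) :=
              Real.rpow_le_rpow_of_exponent_le (by norm_num) (by norm_num)
          _ = 2 := Real.rpow_one 2
      nlinarith
    · rw [min_eq_right h, Real.one_rpow]; linarith
  obtain ⟨hmem, hle⟩ := SQG.hNorm_sq_le hγ0 hγ1 (hH3 t ht) (hcrit t ht)
  refine ⟨hmem, ?_⟩
  have hy : 0 < t ^ (-(1 / 3) : ℝ) := Real.rpow_pos_of_pos ht _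
  have ey : t ^ (-(2 / 3) : ℝ) = (t ^ (-(1 / 3) : ℝ)) ^ 2 := by
    rw [← Real.rpow_natCast, ← Real.rpow_mul ht.le]; norm_num
  set y := t ^ (-(1 / 3) : ℝ)
  rw [ey] at hmin
  have hA0 : 0 ≤ A := by positivity
  refine le_of_sq_le_sq ?_ (by positivity)
  rw [mul_pow, Real.sq_sqrt (by positivity)]
  have h5 := mul_le_mul_of_nonneg_left hmin (by positivity : 0 ≤ 3 * M)
  have h6 := hN t ht
  nlinarith [mul_nonneg hM0 hy.le, mul_nonneg hA0 hy.le, mul_nonneg hM0 (sq_nonneg y),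
    mul_nonneg hA0 (sq_nonneg y)]
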